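/- **Theorem.** There exist a non-atomic standard Borel probability space $(X,\mu)$ and an invertible $\mu$-preserving transformation $T$ of $X$ which is ergodic, of rank one, and has the following property. (P) For every integer $N>0$ there is a sequence of natural numbers $n_j\to\infty$ such that for all measurable sets $A,B,C\subseteq X$ $$\lim_{j\to\infty}\mu\bigl(A\cap T^{n_j+N}B\cap T^{2n_j}C\bigr)=\tfrac13\Bigl(\mu(A\cap T^{N}B\cap T^{-N}C)+\mu(A\cap T^{2N}B\cap T^{N}C)+\mu(A\cap B\cap C)\Bigr).$$ Moreover, every ergodic invertible measure-preserving transformation of a probability space that has property (P) is weakly mixing; in particular the above $T$ is weakly mixing. Here $T^kB$ denotes the image of $B$ under $T^k$. *Rank one* means that there are measurable sets $B_j$ and integers $h_j$ such that for every $j$ the sets $B_j,TB_j,\dots,T^{h_j-1}B_j$ are pairwise disjoint, and every measurable set $A$ is approximated by unions $A_j$ of some of these sets in the sense that $\mu(A\,\triangle\,A_j)\to0$. *Weakly mixing* means that $T$ has continuous spectrum: every $f\in L^2(\mu;\mathbb C)$ with $f\circ T=\lambda f$ almost everywhere for some $\lambda\in\mathbb C$ is almost everywhere constant. -/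

import Mathlib

open MeasureTheory Filter Topology

/-- The image `T^k A` of a set `A` under an integer power of an invertible transformation `T`. -/
def powImage {X : Type*} [MeasurableSpace X] (T : X ≃ᵐ X) (k : ℤ) (A : Set X) : Set X :=
  ((T.toEquiv : Equiv.Perm X) ^ k) '' A

/-- Weak mixing (continuous spectrum): `T` preserves `μ`, and the only `L²` eigenfunctions of the
operator `f ↦ f ∘ T` are the (almost everywhere) constant functions. -/
def IsWeaklyMixing {X : Type*} [MeasurableSpace X] (T : X ≃ᵐ X) (μ : Measure X) : Prop :=
  MeasurePreserving T μ μ ∧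
    ∀ (c : ℂ) (f : X → ℂ), MemLp f 2 μ → (fun x => f (T x)) =ᵐ[μ] (fun x => c * f x) →
      ∃ a : ℂ, f =ᵐ[μ] fun _ => a

/-- Rank one: `T` preserves `μ`, and there is a sequence of Rokhlin towers
`B j, T (B j), …, T^(h j - 1) (B j)` (with pairwise disjoint levels) such that every measurable set
is approximated in measure, as `j → ∞`, by unions of levels of the `j`-th tower. -/
def IsRankOne {X : Type*} [MeasurableSpace X] (T : X ≃ᵐ X) (μ : Measure X) : Prop :=
  MeasurePreserving T μ μ ∧
    ∃ (h : ℕ → ℕ) (B : ℕ → Set X),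
      (∀ j, MeasurableSet (B j)) ∧
      (∀ j, ∀ i < h j, ∀ k < h j, i ≠ k →
        Disjoint (powImage T (i : ℤ) (B j)) (powImage T (k : ℤ) (B j))) ∧
      ∀ A : Set X, MeasurableSet A →
        ∃ J : ℕ → Set ℕ, (∀ j, ∀ i ∈ J j, i < h j) ∧
          Tendsto (fun j => μ (symmDiff A (⋃ i ∈ J j, powImage T (i : ℤ) (B j)))) atTop (𝓝 0)

/-- For every `N > 0` there is a sequence `n j → ∞` such that for all measurable `A`, `B`, `C` the
measures of `A ∩ T^(n j + N) B ∩ T^(2 * n j) C` converge to the average of the measures of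
`A ∩ T^N B ∩ T^(-N) C`, `A ∩ T^(2 * N) B ∩ T^N C` and `A ∩ B ∩ C`. -/
def HasTripleLimits {X : Type*} [MeasurableSpace X] (T : X ≃ᵐ X) (μ : Measure X) : Prop :=
  ∀ N : ℕ, 0 < N → ∃ n : ℕ → ℕ, Tendsto n atTop atTop ∧
    ∀ A B C : Set X, MeasurableSet A → MeasurableSet B → MeasurableSet C →
      Tendsto
        (fun j => μ.real (A ∩ powImage T ((n j : ℤ) + N) B ∩ powImage T (2 * (n j : ℤ)) C))
        atTop
        (𝓝 ((1 / 3 : ℝ) *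
          (μ.real (A ∩ powImage T (N : ℤ) B ∩ powImage T (-(N : ℤ)) C)
            + μ.real (A ∩ powImage T (2 * (N : ℤ)) B ∩ powImage T (N : ℤ) C)
            + μ.real (A ∩ B ∩ C))))

/-! Weak mixing. By linearity the limit in (P) passes from sets to simple functions `g` in the
correlation of `conj g`, `g ^ 2` and `conj g` along `T ^ a` and `T ^ b`, and `tripleCorr` is
Lipschitz in the `L¹` norm on functions bounded by one. For a unimodular eigenfunction with
eigenvalue `c` the correlation is `c ^ (b - 2 * a)`. The weights 1, -2, 1 cancel `n j`, so (P) with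
`N = 1` gives `c⁻² = (2 c⁻³ + 1) / 3`, that is `(c - 1) ^ 2 * (c + 2) = 0`. As `‖c‖ = 1`, this
forces `c = 1`, and ergodicity makes the eigenfunction constant. Ergodicity also makes the modulus
of any eigenfunction constant, which reduces the general case to the unimodular one.

Existence. The example is a cutting-and-stacking map, realised as a suspension of the 2-adic
odometer. The `j`-th tower, of height `h`, is cut into `2 ^ (8 * j + 4)` columns, and the numbers of
spacers above successive columns repeat the pattern `2N, N, 0`, where `N` is the spacer unit of the
stage. Put `n = h + N`. Going back from one column base to the preceding one takes time `h + s`,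
where `s` is the spacer count of the preceding column, and going back two takes `2h + s + s'`. So on
columns of index 0, 1, 2 modulo 3 the power `T ^ (n + N)` acts on levels as `T ^ (2N)`, the identity
and `T ^ N`, while `T ^ (2n)` acts as `T ^ N`, the identity and `T ^ (-N)`. Each class has
asymptotic weight `1/3`, which gives (P). The units are chosen so that every `N` recurs at
infinitely many stages.

The passage from columns to arbitrary sets is `IsGeneratingTowers.tendsto_triple`; the arithmetic of
return times is `zpowMap_neg_columnClass`. Rank one follows because the sets approximable by levels
form a σ-algebra containing the generators. -/

/-! ### Integer powers of an invertible transformation. -/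

section IntegerPowers

variable {X : Type*} [MeasurableSpace X]

/-- The integer power `T ^ k` of an invertible transformation, as a permutation. -/
abbrev zpowMap (T : X ≃ᵐ X) (k : ℤ) : Equiv.Perm X := (T.toEquiv : Equiv.Perm X) ^ k

theorem zpowMap_add_apply (T : X ≃ᵐ X) (a b : ℤ) (x : X) :
    zpowMap T (a + b) x = zpowMap T a (zpowMap T b x) := by
  rw [zpowMap, zpow_add]; rfl

theorem zpowMap_one_apply (T : X ≃ᵐ X) (x : X) : zpowMap T 1 x = T x := by
  rw [zpowMap, zpow_one]; rfl

theorem zpowMap_neg_one_apply (T : X ≃ᵐ X) (x : X) : zpowMap T (-1) x = T.symm x := by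
  rw [zpowMap, zpow_neg_one]; rfl

theorem zpowMap_zero_apply (T : X ≃ᵐ X) (x : X) : zpowMap T 0 x = x := by
  rw [zpowMap, zpow_zero]; rfl

theorem zpowMap_neg_apply_self (T : X ≃ᵐ X) (k : ℤ) (x : X) :
    zpowMap T (-k) (zpowMap T k x) = x := by
  rw [← zpowMap_add_apply, neg_add_cancel, zpowMap_zero_apply]

theorem zpowMap_apply_neg_self (T : X ≃ᵐ X) (k : ℤ) (x : X) :
    zpowMap T k (zpowMap T (-k) x) = x := by
  rw [← zpowMap_add_apply, add_neg_cancel, zpowMap_zero_apply]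

theorem measurable_zpowMap (T : X ≃ᵐ X) (k : ℤ) : Measurable (zpowMap T k) := by
  induction k using Int.induction_on with
  | zero =>
    have : ⇑(zpowMap T 0) = id := funext (zpowMap_zero_apply T)
    rw [this]; exact measurable_id
  | succ k ih =>
    have : ⇑(zpowMap T (k + 1)) = zpowMap T k ∘ T :=
      funext fun x => by rw [zpowMap_add_apply, zpowMap_one_apply]; rfl
    rw [this]; exact ih.comp T.measurable
  | pred k ih =>
    have : ⇑(zpowMap T (-k - 1)) = zpowMap T (-k) ∘ T.symm :=
      funext fun x => by rw [sub_eq_add_neg, zpowMap_add_apply, zpowMap_neg_one_apply]; rfl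
    rw [this]; exact ih.comp T.symm.measurable

theorem measurePreserving_zpowMap {T : X ≃ᵐ X} {μ : Measure X} (hT : MeasurePreserving T μ μ)
    (k : ℤ) : MeasurePreserving (zpowMap T k) μ μ := by
  induction k using Int.induction_on with
  | zero =>
    have : ⇑(zpowMap T 0) = id := funext (zpowMap_zero_apply T)
    rw [this]; exact MeasurePreserving.id μ
  | succ k ih =>
    have : ⇑(zpowMap T (k + 1)) = zpowMap T k ∘ T :=
      funext fun x => by rw [zpowMap_add_apply, zpowMap_one_apply]; rfl
    rw [this]; exact ih.comp hT
  | pred k ih =>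
    have : ⇑(zpowMap T (-k - 1)) = zpowMap T (-k) ∘ T.symm :=
      funext fun x => by rw [sub_eq_add_neg, zpowMap_add_apply, zpowMap_neg_one_apply]; rfl
    rw [this]; exact ih.comp (hT.symm T)

theorem powImage_eq_preimage (T : X ≃ᵐ X) (k : ℤ) (A : Set X) :
    powImage T k A = zpowMap T (-k) ⁻¹' A := by
  ext x
  constructor
  · rintro ⟨y, hy, rfl⟩
    change zpowMap T (-k) (zpowMap T k y) ∈ A
    rwa [zpowMap_neg_apply_self]
  · intro hx
    exact ⟨_, hx, zpowMap_apply_neg_self T k x⟩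

theorem mem_powImage {T : X ≃ᵐ X} {k : ℤ} {A : Set X} {x : X} :
    x ∈ powImage T k A ↔ zpowMap T (-k) x ∈ A := by
  rw [powImage_eq_preimage]; rfl

theorem measurableSet_powImage (T : X ≃ᵐ X) (k : ℤ) {A : Set X} (hA : MeasurableSet A) :
    MeasurableSet (powImage T k A) := by
  rw [powImage_eq_preimage]; exact measurable_zpowMap T _ hA

theorem measure_powImage {T : X ≃ᵐ X} {μ : Measure X} (hT : MeasurePreserving T μ μ) (k : ℤ)
    {A : Set X} (hA : MeasurableSet A) : μ (powImage T k A) = μ A := by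
  rw [powImage_eq_preimage]
  exact (measurePreserving_zpowMap hT _).measure_preimage hA.nullMeasurableSet

end IntegerPowers

/-! ### Property (P) and eigenvalues: weak mixing. -/

section TripleCorrelation

variable {X : Type*} [MeasurableSpace X]

/-- The triple correlation `∫ conj g · (g ∘ T^(-a))² · conj (g ∘ T^(-b))`. -/
noncomputable def tripleCorr (T : X ≃ᵐ X) (μ : Measure X) (g : X → ℂ) (a b : ℤ) : ℂ :=
  ∫ x, star (g x) * g (zpowMap T (-a) x) ^ 2 * star (g (zpowMap T (-b) x)) ∂μ

/-- The integrand is constant on each intersection of a fibre of `g` with two translated fibres, so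
the integral becomes a finite combination of the measures that occur in (P). -/
theorem tripleCorr_simpleFunc (T : X ≃ᵐ X) (μ : Measure X) [IsProbabilityMeasure μ]
    (g : SimpleFunc X ℂ) (a b : ℤ) :
    tripleCorr T μ g a b = ∑ p ∈ g.range, ∑ q ∈ g.range, ∑ r ∈ g.range,
      (μ.real (g ⁻¹' {p} ∩ powImage T a (g ⁻¹' {q}) ∩ powImage T b (g ⁻¹' {r})) : ℂ) *
        (star p * q ^ 2 * star r) := by
  classical
  have hm : ∀ p q r, MeasurableSet
      (g ⁻¹' {p} ∩ powImage T a (g ⁻¹' {q}) ∩ powImage T b (g ⁻¹' {r})) := fun p q r =>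
    ((g.measurableSet_fiber p).inter (measurableSet_powImage T a (g.measurableSet_fiber q))).inter
      (measurableSet_powImage T b (g.measurableSet_fiber r))
  have hpt : ∀ x, star (g x) * g (zpowMap T (-a) x) ^ 2 * star (g (zpowMap T (-b) x)) =
      ∑ p ∈ g.range, ∑ q ∈ g.range, ∑ r ∈ g.range,
        (g ⁻¹' {p} ∩ powImage T a (g ⁻¹' {q}) ∩ powImage T b (g ⁻¹' {r})).indicator
          (fun _ => star p * q ^ 2 * star r) x := by
    intro x
    rw [Finset.sum_eq_single (g x), Finset.sum_eq_single (g (zpowMap T (-a) x)),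
      Finset.sum_eq_single (g (zpowMap T (-b) x)), Set.indicator_of_mem]
    · exact ⟨⟨rfl, mem_powImage.2 rfl⟩, mem_powImage.2 rfl⟩
    · intro r _ hr
      exact Set.indicator_of_notMem (fun h => hr (mem_powImage.1 h.2).symm) _
    · intro h; exact absurd (g.mem_range_self _) h
    · intro q _ hq
      exact Finset.sum_eq_zero fun r _ =>
        Set.indicator_of_notMem (fun h => hq (mem_powImage.1 h.1.2).symm) _
    · intro h; exact absurd (g.mem_range_self _) h
    · intro p _ hp
      exact Finset.sum_eq_zero fun q _ => Finset.sum_eq_zero fun r _ =>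
        Set.indicator_of_notMem (fun h => hp h.1.1.symm) _
    · intro h; exact absurd (g.mem_range_self _) h
  have hi : ∀ p q r, Integrable
      ((g ⁻¹' {p} ∩ powImage T a (g ⁻¹' {q}) ∩ powImage T b (g ⁻¹' {r})).indicator
          (fun _ => star p * q ^ 2 * star r)) μ := fun p q r =>
    (integrable_const _).indicator (hm p q r)
  rw [tripleCorr]
  simp_rw [hpt]
  rw [integral_finsetSum _ fun p _ => integrable_finsetSum _ fun q _ =>
    integrable_finsetSum _ fun r _ => hi p q r]
  refine Finset.sum_congr rfl fun p _ => ?_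
  rw [integral_finsetSum _ fun q _ => integrable_finsetSum _ fun r _ => hi p q r]
  refine Finset.sum_congr rfl fun q _ => ?_
  rw [integral_finsetSum _ fun r _ => hi p q r]
  refine Finset.sum_congr rfl fun r _ => ?_
  rw [integral_indicator_const _ (hm p q r), Complex.real_smul]

theorem HasTripleLimits.tendsto_tripleCorr {T : X ≃ᵐ X} {μ : Measure X} [IsProbabilityMeasure μ]
    (h : HasTripleLimits T μ) {N : ℕ} (hN : 0 < N) :
    ∃ n : ℕ → ℕ, ∀ g : SimpleFunc X ℂ,
      Tendsto (fun j => tripleCorr T μ g (n j + N) (2 * n j)) atTop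
        (𝓝 (1 / 3 * (tripleCorr T μ g N (-N) + tripleCorr T μ g (2 * N) N
          + tripleCorr T μ g 0 0))) := by
  obtain ⟨n, -, hn⟩ := h N hN
  refine ⟨n, fun g => ?_⟩
  simp only [tripleCorr_simpleFunc, ← Finset.sum_add_distrib, Finset.mul_sum]
  refine tendsto_finsetSum _ fun p _ => tendsto_finsetSum _ fun q _ =>
    tendsto_finsetSum _ fun r _ => ?_
  have := hn _ _ _ (g.measurableSet_fiber p) (g.measurableSet_fiber q) (g.measurableSet_fiber r)
  have h2 := ((Complex.continuous_ofReal.tendsto _).comp this).mul_const (star p * q ^ 2 * star r)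
  have h0 : ∀ A : Set X, powImage T 0 A = A := fun A => by
    ext x; rw [mem_powImage, neg_zero, zpowMap_zero_apply]
  convert h2 using 2
  · rfl
  · push_cast
    rw [h0, h0]
    ring

theorem norm_tripleProd_sub_le {a b c a' b' c' : ℂ} (hb : ‖b‖ ≤ 1) (hc : ‖c‖ ≤ 1)
    (ha' : ‖a'‖ ≤ 1) (hb' : ‖b'‖ ≤ 1) :
    ‖star a * b ^ 2 * star c - star a' * b' ^ 2 * star c'‖ ≤
      ‖a - a'‖ + 2 * ‖b - b'‖ + ‖c - c'‖ := by
  have e : star a * b ^ 2 * star c - star a' * b' ^ 2 * star c' =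
      star (a - a') * (b ^ 2 * star c) + (b - b') * ((b + b') * (star a' * star c))
        + star (c - c') * (star a' * b' ^ 2) := by
    simp only [star_sub]; ring
  rw [e]
  have hbb : ‖b + b'‖ ≤ 2 := (norm_add_le _ _).trans (by linarith)
  refine (norm_add₃_le).trans ?_
  simp only [norm_mul, norm_star, norm_pow]
  have h1 : ‖b‖ ^ 2 * ‖c‖ ≤ 1 := mul_le_one₀ (pow_le_one₀ (norm_nonneg _) hb) (norm_nonneg _) hc
  have h2 : ‖a'‖ * ‖c‖ ≤ 1 := mul_le_one₀ ha' (norm_nonneg _) hc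
  have h3 : ‖a'‖ * ‖b'‖ ^ 2 ≤ 1 :=
    mul_le_one₀ ha' (by positivity) (pow_le_one₀ (norm_nonneg _) hb')
  have h4 : ‖b + b'‖ * (‖a'‖ * ‖c‖) ≤ 2 := by
    calc _ ≤ 2 * 1 := mul_le_mul hbb h2 (by positivity) (by norm_num)
      _ = 2 := by norm_num
  have k1 := mul_le_mul_of_nonneg_left h1 (norm_nonneg (a - a'))
  have k2 := mul_le_mul_of_nonneg_left h4 (norm_nonneg (b - b'))
  have k3 := mul_le_mul_of_nonneg_left h3 (norm_nonneg (c - c'))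
  linarith

/-- The product is telescoped one factor at a time. Invariance of `μ` makes all translated
differences have the same integral, and the constant is `1 + 2 + 1`. -/
theorem norm_tripleCorr_sub_le {T : X ≃ᵐ X} {μ : Measure X} [IsProbabilityMeasure μ]
    (hT : MeasurePreserving T μ μ) {u g : X → ℂ} (hu : Measurable u) (hg : Measurable g)
    (hu1 : ∀ x, ‖u x‖ ≤ 1) (hg1 : ∀ x, ‖g x‖ ≤ 1) (a b : ℤ) :
    ‖tripleCorr T μ u a b - tripleCorr T μ g a b‖ ≤ 4 * ∫ x, ‖u x - g x‖ ∂μ := by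
  have hmeas : ∀ f : X → ℂ, Measurable f → Measurable fun x =>
      star (f x) * f (zpowMap T (-a) x) ^ 2 * star (f (zpowMap T (-b) x)) := fun f hf =>
    ((continuous_star.measurable.comp hf).mul
      ((hf.comp (measurable_zpowMap T _)).pow_const 2)).mul
      (continuous_star.measurable.comp (hf.comp (measurable_zpowMap T _)))
  have hint : ∀ f : X → ℂ, Measurable f → (∀ x, ‖f x‖ ≤ 1) → Integrable (fun x =>
      star (f x) * f (zpowMap T (-a) x) ^ 2 * star (f (zpowMap T (-b) x))) μ := fun f hf h1 => by
    refine Integrable.of_bound (hmeas f hf).aestronglyMeasurable 1 (.of_forall fun x => ?_)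
    simp only [norm_mul, norm_star, norm_pow]
    exact mul_le_one₀ (mul_le_one₀ (h1 _) (by positivity) (pow_le_one₀ (norm_nonneg _) (h1 _)))
      (norm_nonneg _) (h1 _)
  have hd : Integrable (fun x => ‖u x - g x‖) μ := by
    refine Integrable.of_bound (hu.sub hg).norm.aestronglyMeasurable 2 (.of_forall fun x => ?_)
    rw [norm_norm]
    exact (norm_sub_le _ _).trans (by linarith [hu1 x, hg1 x])
  have hdk : ∀ k : ℤ, Integrable (fun x => ‖u (zpowMap T k x) - g (zpowMap T k x)‖) μ := fun k =>
    (measurePreserving_zpowMap hT k).integrable_comp_of_integrable hd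
  have hik : ∀ k : ℤ, ∫ x, ‖u (zpowMap T k x) - g (zpowMap T k x)‖ ∂μ = ∫ x, ‖u x - g x‖ ∂μ :=
    fun k => by
      have hm : AEStronglyMeasurable (fun x => ‖u x - g x‖) (μ.map (zpowMap T k)) :=
        (hu.sub hg).norm.aestronglyMeasurable
      have := integral_map (measurable_zpowMap T k).aemeasurable hm
      rwa [(measurePreserving_zpowMap hT k).map_eq, eq_comm] at this
  rw [tripleCorr, tripleCorr, ← integral_sub (hint u hu hu1) (hint g hg hg1)]
  refine (norm_integral_le_integral_norm _).trans ?_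
  calc _ ≤ ∫ x, (‖u x - g x‖ + 2 * ‖u (zpowMap T (-a) x) - g (zpowMap T (-a) x)‖
        + ‖u (zpowMap T (-b) x) - g (zpowMap T (-b) x)‖) ∂μ :=
        integral_mono ((hint u hu hu1).sub (hint g hg hg1)).norm
          ((hd.add ((hdk _).const_mul 2)).add (hdk _)) fun x =>
            norm_tripleProd_sub_le (hu1 _) (hu1 _) (hg1 _) (hg1 _)
    _ = 4 * ∫ x, ‖u x - g x‖ ∂μ := by
        have e1 := integral_add (hd.add ((hdk (-a)).const_mul 2)) (hdk (-b))
        have e2 := integral_add hd ((hdk (-a)).const_mul 2)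
        simp only [Pi.add_apply] at e1
        rw [e1, e2, integral_const_mul, hik, hik]
        ring

theorem ae_eq_zpowMap {T : X ≃ᵐ X} {μ : Measure X} (hT : MeasurePreserving T μ μ) {u : X → ℂ}
    {c : ℂ} (hc : c ≠ 0) (hu : (fun x => u (T x)) =ᵐ[μ] fun x => c * u x) (k : ℤ) :
    (fun x => u (zpowMap T k x)) =ᵐ[μ] fun x => c ^ k * u x := by
  have hs : (fun x => u (T.symm x)) =ᵐ[μ] fun x => c⁻¹ * u x := by
    filter_upwards [(hT.symm T).quasiMeasurePreserving.ae hu] with x hx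
    rw [T.apply_symm_apply] at hx
    rw [hx, inv_mul_cancel_left₀ hc]
  induction k using Int.induction_on with
  | zero => exact .of_forall fun x => by simp
  | succ k ih =>
    filter_upwards [hT.quasiMeasurePreserving.ae ih, hu] with x h1 h2
    rw [zpowMap_add_apply, zpowMap_one_apply, h1, h2, zpow_add₀ hc, zpow_one, mul_assoc]
  | pred k ih =>
    filter_upwards [(hT.symm T).quasiMeasurePreserving.ae ih, hs] with x h1 h2
    rw [sub_eq_add_neg, zpowMap_add_apply, zpowMap_neg_one_apply, h1, h2, zpow_add₀ hc,
      zpow_neg_one, mul_assoc]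

theorem tripleCorr_eigenfunction {T : X ≃ᵐ X} {μ : Measure X} [IsProbabilityMeasure μ]
    (hT : MeasurePreserving T μ μ) {u : X → ℂ} (hu1 : ∀ x, ‖u x‖ = 1) {c : ℂ} (hc : ‖c‖ = 1)
    (hu : (fun x => u (T x)) =ᵐ[μ] fun x => c * u x) (a b : ℤ) :
    tripleCorr T μ u a b = c ^ (b - 2 * a) := by
  have hc0 : c ≠ 0 := by rintro rfl; simp at hc
  have hn : ∀ z : ℂ, ‖z‖ = 1 → star z * z = 1 := fun z hz => by
    have := Complex.normSq_eq_conj_mul_self (z := z)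
    rw [Complex.normSq_eq_norm_sq, hz] at this
    simpa using this.symm
  have hcs : ∀ k : ℤ, star (c ^ k) = c ^ (-k) := fun k => by
    have h := hn (c ^ k) (by rw [norm_zpow, hc, one_zpow])
    rw [zpow_neg]
    exact eq_inv_of_mul_eq_one_left h
  have : (fun x => star (u x) * u (zpowMap T (-a) x) ^ 2 * star (u (zpowMap T (-b) x))) =ᵐ[μ]
      fun _ => c ^ (b - 2 * a) := by
    filter_upwards [ae_eq_zpowMap hT hc0 hu (-a), ae_eq_zpowMap hT hc0 hu (-b)] with x h1 h2
    rw [h1, h2, star_mul, hcs, neg_neg, sub_eq_add_neg, zpow_add₀ hc0,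
      show -(2 * a) = -a + -a by ring, zpow_add₀ hc0]
    linear_combination (c ^ b * (c ^ (-a) * c ^ (-a))) * (star (u x) * u x + 1) * hn _ (hu1 x)
  rw [tripleCorr, integral_congr_ae this]
  simp

theorem eq_one_of_eigenvalue {T : X ≃ᵐ X} {μ : Measure X} [IsProbabilityMeasure μ]
    (hT : MeasurePreserving T μ μ) (h : HasTripleLimits T μ) {u : X → ℂ} (hm : Measurable u)
    (hu1 : ∀ x, ‖u x‖ = 1) {c : ℂ} (hc : ‖c‖ = 1)
    (hu : (fun x => u (T x)) =ᵐ[μ] fun x => c * u x) : c = 1 := by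
  have hc0 : c ≠ 0 := by rintro rfl; simp at hc
  obtain ⟨n, hn⟩ := h.tendsto_tripleCorr one_pos
  have hbd : ∀ ε > 0, ‖c ^ (-2 : ℤ) - 1 / 3 * (c ^ (-3 : ℤ) + c ^ (-3 : ℤ) + 1)‖ ≤ ε := by
    intro ε hε
    -- Simple approximants with values on the unit circle stay bounded by one, as the Lipschitz
    -- estimate requires.
    let s : Set ℂ := Metric.sphere 0 1
    have h1s : (1 : ℂ) ∈ s := by simp [s]
    have hus : ∀ x, u x ∈ s := fun x => by simpa [s] using hu1 x
    have happ := SimpleFunc.tendsto_approxOn_L1_enorm (f := u) hm h1s (μ := μ)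
      (.of_forall fun x => subset_closure (hus x))
      (by
        have : Integrable (fun x => u x - 1) μ := Integrable.of_bound
          (hm.sub_const 1).aestronglyMeasurable 2 (.of_forall fun x =>
            (norm_sub_le _ _).trans (by rw [hu1]; norm_num))
        exact this.2)
    -- The Lipschitz constant 4 turns `ε / 8` into `ε / 2`. This error enters twice: once in the
    -- limit and once in the average of three terms.
    have hδ : (0 : ENNReal) < ENNReal.ofReal (ε / 8) := by simpa using hε
    obtain ⟨k, hk⟩ := (happ.eventually (gt_mem_nhds hδ)).exists
    set g := SimpleFunc.approxOn u hm s 1 h1s k with hg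
    have hg1 : ∀ x, ‖g x‖ ≤ 1 := fun x => by
      have := SimpleFunc.approxOn_mem hm h1s k x
      exact le_of_eq (by simpa [s] using this)
    have hL : ∫ x, ‖u x - g x‖ ∂μ ≤ ε / 8 := by
      have : ∫ x, ‖u x - g x‖ ∂μ = (∫⁻ x, ‖g x - u x‖ₑ ∂μ).toReal := by
        have e : AEStronglyMeasurable (fun x => u x - g x) μ :=
          (hm.sub g.measurable).aestronglyMeasurable
        rw [integral_norm_eq_lintegral_enorm e]
        simp_rw [enorm_sub_rev]
      rw [this]
      exact ENNReal.toReal_le_of_le_ofReal (by positivity) hk.le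
    have hD := fun a b =>
      (norm_tripleCorr_sub_le hT hm g.measurable (fun x => (hu1 x).le) hg1 a b).trans
        (show _ ≤ ε / 2 by linarith)
    simp only [tripleCorr_eigenfunction hT hu1 hc hu] at hD
    have hlim := (tendsto_const_nhds (x := c ^ (-2 : ℤ))).sub (hn g) |>.norm
    have hle := le_of_tendsto hlim (.of_forall fun j => by
      have := hD (n j + (1 : ℕ)) (2 * n j)
      rwa [show (2 * (n j : ℤ) - 2 * (n j + (1 : ℕ))) = -2 by push_cast; ring] at this)
    have e1 := hD (1 : ℕ) (-(1 : ℕ))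
    have e2 := hD (2 * (1 : ℕ)) (1 : ℕ)
    have e3 := hD 0 0
    norm_num at e1 e2 e3 hle
    have : c ^ (-2 : ℤ) - 1 / 3 * (c ^ (-3 : ℤ) + c ^ (-3 : ℤ) + 1) =
        (c ^ (-2 : ℤ) - 1 / 3 * (tripleCorr T μ g 1 (-1) + tripleCorr T μ g 2 1
          + tripleCorr T μ g 0 0)) - 1 / 3 * ((c ^ (-3 : ℤ) - tripleCorr T μ g 1 (-1))
          + (c ^ (-3 : ℤ) - tripleCorr T μ g 2 1) + (1 - tripleCorr T μ g 0 0)) := by ring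
    rw [this]
    refine (norm_sub_le _ _).trans ?_
    rw [norm_mul]
    have h3 := norm_add₃_le (a := c ^ (-3 : ℤ) - tripleCorr T μ g 1 (-1))
      (b := c ^ (-3 : ℤ) - tripleCorr T μ g 2 1) (c := 1 - tripleCorr T μ g 0 0)
    norm_num at h3 e1 e2 e3 hle ⊢
    linarith
  have h0 : c ^ (-2 : ℤ) - 1 / 3 * (c ^ (-3 : ℤ) + c ^ (-3 : ℤ) + 1) = 0 :=
    norm_le_zero_iff.1 (le_of_forall_pos_le_add fun ε hε => by simpa using hbd ε hε)
  have hpoly : (c - 1) ^ 2 * (c + 2) = 0 := by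
    rw [show (-2 : ℤ) = -(2 : ℕ) by rfl, show (-3 : ℤ) = -(3 : ℕ) by rfl, zpow_neg, zpow_neg,
      zpow_natCast, zpow_natCast] at h0
    field_simp at h0
    linear_combination -h0
  rcases mul_eq_zero.1 hpoly with h1 | h1
  · exact sub_eq_zero.1 (pow_eq_zero_iff (two_ne_zero)|>.1 h1)
  · rw [eq_neg_of_add_eq_zero_left h1] at hc
    norm_num at hc

theorem isWeaklyMixing_of_hasTripleLimits {T : X ≃ᵐ X} {μ : Measure X} [IsProbabilityMeasure μ]
    (hT : Ergodic T μ) (h : HasTripleLimits T μ) : IsWeaklyMixing T μ := by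
  have hmp := hT.toMeasurePreserving
  refine ⟨hmp, fun c f hf hcf => ?_⟩
  set f' := hf.1.mk f with hf'
  have hm : Measurable f' := hf.1.stronglyMeasurable_mk.measurable
  have hff : f =ᵐ[μ] f' := hf.1.ae_eq_mk
  have hcf' : (fun x => f' (T x)) =ᵐ[μ] fun x => c * f' x := by
    filter_upwards [hff, hmp.quasiMeasurePreserving.ae hff, hcf] with x h1 h2 h3
    rw [← h1, ← h2, h3]
  by_cases hz : f' =ᵐ[μ] 0
  · exact ⟨0, hff.trans hz⟩
  have hpos : ∫⁻ x, ‖f' x‖ₑ ^ (2 : ℝ) ∂μ ≠ 0 := by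
    intro h0
    rw [lintegral_eq_zero_iff (hm.enorm.pow_const _)] at h0
    refine hz (h0.mono fun x hx => ?_)
    simpa using hx
  have hfin : ∫⁻ x, ‖f' x‖ₑ ^ (2 : ℝ) ∂μ ≠ ⊤ := by
    have := ((memLp_congr_ae hff).1 hf).eLpNorm_lt_top
    rw [eLpNorm_lt_top_iff_lintegral_rpow_enorm_lt_top (by norm_num) (by norm_num)] at this
    simpa using this.ne
  -- Composition with `T` preserves the `L²` norm, which is finite and nonzero.
  have hc1 : ‖c‖ = 1 := by
    have e1 : ∫⁻ x, ‖f' (T x)‖ₑ ^ (2 : ℝ) ∂μ = ∫⁻ x, ‖f' x‖ₑ ^ (2 : ℝ) ∂μ :=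
      hmp.lintegral_comp (hm.enorm.pow_const _)
    have e2 : ∫⁻ x, ‖f' (T x)‖ₑ ^ (2 : ℝ) ∂μ = ‖c‖ₑ ^ (2 : ℝ) * ∫⁻ x, ‖f' x‖ₑ ^ (2 : ℝ) ∂μ := by
      rw [← lintegral_const_mul _ (hm.enorm.pow_const _)]
      refine lintegral_congr_ae (hcf'.mono fun x hx => ?_)
      simp only [] at hx ⊢
      rw [hx, enorm_mul, ENNReal.mul_rpow_of_nonneg _ _ (by norm_num)]
    rw [e1] at e2
    have e3 : ‖c‖ₑ ^ (2 : ℝ) = 1 := by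
      have := e2.symm.trans (one_mul _).symm
      exact (ENNReal.mul_left_inj hpos hfin).1 this
    have e4 : ‖c‖ₑ = 1 := by
      exact ENNReal.rpow_left_injective (two_ne_zero (α := ℝ)) (e3.trans (ENNReal.one_rpow _).symm)
    have := congrArg ENNReal.toReal e4
    simpa using this
  have hconst : ∃ r : ℝ, (fun x => ‖f' x‖) =ᵐ[μ] fun _ => r := by
    refine hT.ae_eq_const_of_ae_eq_comp_ae hm.norm.aestronglyMeasurable ?_
    filter_upwards [hcf'] with x hx
    simp only [Function.comp] at hx ⊢
    rw [hx, norm_mul, hc1, one_mul]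
  obtain ⟨r, hr⟩ := hconst
  have hr0 : r ≠ 0 := by
    rintro rfl
    exact hz (hr.mono fun x hx => by simpa using hx)
  have hrpos : 0 < r := by
    obtain ⟨x, hx⟩ := hr.exists
    exact lt_of_le_of_ne ((norm_nonneg (f' x)).trans hx.le) hr0.symm
  classical
  -- The value 1 on the null set where the modulus differs from `r` makes `u` unimodular at every
  -- point.
  let u : X → ℂ := fun x => if ‖f' x‖ = r then f' x / r else 1
  have hum : Measurable u :=
    Measurable.ite (measurableSet_eq_fun hm.norm measurable_const) (hm.div_const _)
      measurable_const
  have hu1 : ∀ x, ‖u x‖ = 1 := fun x => by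
    by_cases hx : ‖f' x‖ = r
    · simp [u, hx, abs_of_pos hrpos, hr0]
    · simp [u, hx]
  have huf : u =ᵐ[μ] fun x => f' x / r := hr.mono fun x hx => if_pos hx
  have hcu : (fun x => u (T x)) =ᵐ[μ] fun x => c * u x := by
    filter_upwards [huf, hmp.quasiMeasurePreserving.ae huf, hcf'] with x h1 h2 h3
    rw [h1, h2, h3, mul_div_assoc]
  have hc : c = 1 := eq_one_of_eigenvalue hmp h hum hu1 hc1 hcu
  obtain ⟨a, ha⟩ := hT.ae_eq_const_of_ae_eq_comp_ae hm.aestronglyMeasurable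
    (hcf'.mono fun x hx => by simpa [hc] using hx)
  exact ⟨a, hff.trans ha⟩

end TripleCorrelation

/-! ### Rokhlin towers and the limit of triple intersections. -/

section Towers

variable {X : Type*} [MeasurableSpace X]

/-- The levels `B, T B, …, T ^ (h - 1) B` are pairwise disjoint. -/
def IsTower (T : X ≃ᵐ X) (B : Set X) (h : ℕ) : Prop :=
  ∀ i < h, ∀ k < h, i ≠ k → Disjoint (powImage T (i : ℤ) B) (powImage T (k : ℤ) B)

/-- The union of the levels `T ^ i B` with `i ∈ J`. -/
def levelUnion (T : X ≃ᵐ X) (B : Set X) (J : Set ℕ) : Set X :=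
  ⋃ i ∈ J, powImage T (i : ℤ) B

theorem mem_levelUnion {T : X ≃ᵐ X} {B : Set X} {J : Set ℕ} {y : X} :
    y ∈ levelUnion T B J ↔ ∃ i ∈ J, zpowMap T (-(i : ℤ)) y ∈ B := by
  simp only [levelUnion, Set.mem_iUnion, mem_powImage, exists_prop]

theorem measurableSet_levelUnion (T : X ≃ᵐ X) {B : Set X} (hB : MeasurableSet B) (J : Set ℕ) :
    MeasurableSet (levelUnion T B J) :=
  MeasurableSet.biUnion J.to_countable fun _ _ => measurableSet_powImage T _ hB

theorem IsTower.mono {T : X ≃ᵐ X} {B W : Set X} {h : ℕ} (ht : IsTower T B h) (hW : W ⊆ B) :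
    IsTower T W h := fun i hi k hk hik =>
  (ht i hi k hk hik).mono (Set.image_mono hW) (Set.image_mono hW)

theorem IsTower.eq_of_mem {T : X ≃ᵐ X} {B : Set X} {h : ℕ} (ht : IsTower T B h) {i k : ℕ}
    (hi : i < h) (hk : k < h) {y : X} (h1 : zpowMap T (-(i : ℤ)) y ∈ B)
    (h2 : zpowMap T (-(k : ℤ)) y ∈ B) : i = k := by
  by_contra hik
  exact Set.disjoint_left.1 (ht i hi k hk hik) (mem_powImage.2 h1) (mem_powImage.2 h2)

theorem IsTower.mem_levelUnion_iff {T : X ≃ᵐ X} {B : Set X} {h : ℕ} (ht : IsTower T B h)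
    {J : Set ℕ} (hJ : ∀ i ∈ J, i < h) {m : ℕ} (hm : m < h) {x : X} (hx : x ∈ B) :
    zpowMap T m x ∈ levelUnion T B J ↔ m ∈ J := by
  have hmx : zpowMap T (-(m : ℤ)) (zpowMap T m x) ∈ B := by rwa [zpowMap_neg_apply_self]
  rw [mem_levelUnion]
  constructor
  · rintro ⟨i, hi, hiB⟩
    rwa [ht.eq_of_mem hm (hJ i hi) hmx hiB]
  · exact fun hmJ => ⟨m, hmJ, hmx⟩

theorem IsTower.measureReal_levelUnion {T : X ≃ᵐ X} {μ : Measure X} [IsFiniteMeasure μ]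
    (hT : MeasurePreserving T μ μ) {B : Set X} {h : ℕ} (ht : IsTower T B h)
    (hB : MeasurableSet B) (S : Finset ℕ) (hS : ∀ i ∈ S, i < h) :
    μ.real (levelUnion T B S) = S.card * μ.real B := by
  have : levelUnion T B S = ⋃ i ∈ S, powImage T (i : ℤ) B := by simp [levelUnion]
  rw [this, measureReal_biUnion_finset]
  · simp [measureReal_def, measure_powImage hT _ hB]
  · intro i hi k hk hik
    exact ht i (hS i hi) k (hS k hk) hik
  · exact fun i _ => measurableSet_powImage T _ hB

theorem IsTower.height_mul_measureReal_le_one {T : X ≃ᵐ X} {μ : Measure X}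
    [IsProbabilityMeasure μ] (hT : MeasurePreserving T μ μ) {B : Set X} {h : ℕ}
    (ht : IsTower T B h) (hB : MeasurableSet B) : h * μ.real B ≤ 1 := by
  have := ht.measureReal_levelUnion hT hB (Finset.range h) fun i hi => Finset.mem_range.1 hi
  rw [Finset.card_range] at this
  rw [← this]
  exact measureReal_le_one

/-- The part of the tower over `W` that stays away from the bottom and top `L` levels. -/
def innerTower (T : X ≃ᵐ X) (W : Set X) (h L : ℕ) : Set X :=
  levelUnion T W (Finset.Ico L (h - L) : Finset ℕ)

theorem IsTower.levelUnion_inter_innerTower {T : X ≃ᵐ X} {B W : Set X} {h : ℕ}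
    (ht : IsTower T B h) (hW : W ⊆ B) (S : Finset ℕ) (hS : ∀ i ∈ S, i < h) (L : ℕ) :
    levelUnion T B S ∩ innerTower T W h L =
      levelUnion T W (S ∩ Finset.Ico L (h - L) : Finset ℕ) := by
  ext y
  simp only [innerTower, Set.mem_inter_iff, mem_levelUnion, Finset.mem_coe, Finset.mem_inter,
    Finset.mem_Ico]
  constructor
  · rintro ⟨⟨i, hi, hiB⟩, k, hk, hkW⟩
    obtain rfl : i = k := ht.eq_of_mem (hS i hi) (by omega) hiB (hW hkW)
    exact ⟨i, ⟨hi, hk⟩, hkW⟩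
  · rintro ⟨i, ⟨hi, hi'⟩, hiW⟩
    exact ⟨⟨i, hi, hW hiW⟩, i, hi', hiW⟩

/-- All levels over `W` have equal measure, so within a union of levels the tower over `W` has
relative measure `μ W / μ B`. The truncation loses at most `2 * L` levels. -/
theorem IsTower.abs_measureReal_inter_innerTower_sub_le {T : X ≃ᵐ X} {μ : Measure X}
    [IsProbabilityMeasure μ] (hT : MeasurePreserving T μ μ) {B W : Set X} {h : ℕ}
    (ht : IsTower T B h) (hB : MeasurableSet B) (hWm : MeasurableSet W) (hW : W ⊆ B)
    (S : Finset ℕ) (hS : ∀ i ∈ S, i < h) (L : ℕ) (w : ℝ) :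
    |μ.real (levelUnion T B S ∩ innerTower T W h L) - w * μ.real (levelUnion T B S)| ≤
      |μ.real W / μ.real B - w| + |w| * (2 * L * μ.real B) := by
  rw [ht.levelUnion_inter_innerTower hW S hS, ht.measureReal_levelUnion hT hB S hS,
    (ht.mono hW).measureReal_levelUnion hT hWm _ fun i hi => hS i (Finset.mem_inter.1 hi).1]
  set S' := S ∩ Finset.Ico L (h - L)
  have h1 : S'.card ≤ h := by
    calc S'.card ≤ (Finset.range h).card :=
          Finset.card_le_card fun i hi => Finset.mem_range.2 (hS i (Finset.mem_inter.1 hi).1)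
      _ = h := Finset.card_range h
  have h2 : S'.card ≤ S.card := Finset.card_le_card Finset.inter_subset_left
  have h3 : S.card ≤ S'.card + 2 * L := by
    have hsub : S ⊆ S' ∪ (Finset.range L ∪ Finset.Ico (h - L) h) := by
      intro i hi
      have := hS i hi
      simp only [S', Finset.mem_union, Finset.mem_inter, Finset.mem_Ico, Finset.mem_range]
      by_cases h4 : i < L
      · exact .inr (.inl h4)
      · by_cases h5 : i < h - L
        · exact .inl ⟨hi, by omega, h5⟩
        · exact .inr (.inr ⟨by omega, this⟩)
    refine (Finset.card_le_card hsub).trans ((Finset.card_union_le _ _).trans ?_)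
    have := Finset.card_union_le (Finset.range L) (Finset.Ico (h - L) h)
    rw [Finset.card_range, Nat.card_Ico] at this
    omega
  have hb := ht.height_mul_measureReal_le_one hT hB
  have hWB : μ.real W = μ.real W / μ.real B * μ.real B := by
    by_cases h0 : μ.real B = 0
    · rw [h0, mul_zero]
      exact le_antisymm (h0 ▸ measureReal_mono hW) measureReal_nonneg
    · rw [div_mul_cancel₀ _ h0]
  set ρ := μ.real W / μ.real B
  have hB0 : 0 ≤ μ.real B := measureReal_nonneg
  have h2' : (S'.card : ℝ) ≤ S.card := by exact_mod_cast h2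
  have h3' : (S.card : ℝ) ≤ S'.card + 2 * L := by exact_mod_cast h3
  have h1' : (S'.card : ℝ) * μ.real B ≤ 1 :=
    (mul_le_mul_of_nonneg_right (by exact_mod_cast h1) hB0).trans hb
  rw [hWB]
  calc |S'.card * (ρ * μ.real B) - w * (S.card * μ.real B)|
      = |(ρ - w) * (S'.card * μ.real B) - w * ((S.card - S'.card) * μ.real B)| := by
        congr 1; ring
    _ ≤ |(ρ - w) * (S'.card * μ.real B)| + |w * ((S.card - S'.card) * μ.real B)| := abs_sub _ _
    _ ≤ |ρ - w| + |w| * (2 * L * μ.real B) := by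
        rw [abs_mul (ρ - w), abs_mul w]
        have e1 : |(S'.card : ℝ) * μ.real B| ≤ 1 := by rwa [abs_of_nonneg (by positivity)]
        have e2 : |((S.card : ℝ) - S'.card) * μ.real B| ≤ 2 * L * μ.real B := by
          rw [abs_of_nonneg (mul_nonneg (by linarith) hB0)]
          exact mul_le_mul_of_nonneg_right (by linarith) hB0
        exact add_le_add (mul_le_of_le_one_right (abs_nonneg _) e1)
          (mul_le_mul_of_nonneg_left e2 (abs_nonneg _))

theorem abs_measureReal_sub_le_symmDiff {μ : Measure X} [IsFiniteMeasure μ] (A B : Set X) :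
    |μ.real A - μ.real B| ≤ μ.real (symmDiff A B) := by
  have h1 : μ.real A ≤ μ.real B + μ.real (symmDiff A B) :=
    (measureReal_mono (fun x hx => by
      by_cases hB : x ∈ B
      · exact .inl hB
      · exact .inr (.inl ⟨hx, hB⟩))).trans (measureReal_union_le _ _)
  have h2 : μ.real B ≤ μ.real A + μ.real (symmDiff A B) :=
    (measureReal_mono (fun x hx => by
      by_cases hA : x ∈ A
      · exact .inl hA
      · exact .inr (.inr ⟨hx, hA⟩))).trans (measureReal_union_le _ _)
  exact abs_sub_le_iff.2 ⟨by linarith, by linarith⟩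

/-- If `y` is at level `i` over a point of `W`, both `T ^ (-u) y` and `T ^ (-α) y` lie in level `i -
α`. The margin `L` keeps this index inside the tower. -/
theorem mem_powImage_levelUnion_iff_of_mem_innerTower {T : X ≃ᵐ X} {B W : Set X} {h : ℕ}
    (ht : IsTower T B h) (hW : W ⊆ B) {J : Set ℕ} (hJ : ∀ i ∈ J, i < h) {L : ℕ} {u α : ℤ}
    (hα : |α| ≤ L) (hu : ∀ x ∈ W, zpowMap T (-(u - α)) x ∈ B) {y : X}
    (hy : y ∈ innerTower T W h L) :
    y ∈ powImage T u (levelUnion T B J) ↔ y ∈ powImage T α (levelUnion T B J) := by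
  obtain ⟨i, hi, hiW⟩ := mem_levelUnion.1 hy
  rw [Finset.mem_coe, Finset.mem_Ico] at hi
  obtain ⟨hα1, hα2⟩ := abs_le.1 hα
  obtain ⟨m, hm⟩ : ∃ m : ℕ, (m : ℤ) = i - α := ⟨(i - α).toNat, by omega⟩
  have hmh : m < h := by omega
  rw [mem_powImage, mem_powImage]
  have e1 : zpowMap T (-u) y =
      zpowMap T m (zpowMap T (-(u - α)) (zpowMap T (-(i : ℤ)) y)) := by
    rw [← zpowMap_add_apply, ← zpowMap_add_apply]; congr 2; rw [hm]; ring
  have e2 : zpowMap T (-α) y = zpowMap T m (zpowMap T (-(i : ℤ)) y) := by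
    rw [← zpowMap_add_apply]; congr 2; rw [hm]; ring
  rw [e1, e2, ht.mem_levelUnion_iff hJ hmh (hu _ hiW), ht.mem_levelUnion_iff hJ hmh (hW hiW)]

theorem IsTower.disjoint_innerTower {T : X ≃ᵐ X} {B V W : Set X} {h : ℕ} (ht : IsTower T B h)
    (hV : V ⊆ B) (hW : W ⊆ B) (hVW : Disjoint V W) (L : ℕ) :
    Disjoint (innerTower T V h L) (innerTower T W h L) := by
  rw [Set.disjoint_left]
  intro y hy hy'
  obtain ⟨i, hi, hiV⟩ := mem_levelUnion.1 hy
  obtain ⟨k, hk, hkW⟩ := mem_levelUnion.1 hy'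
  rw [Finset.mem_coe, Finset.mem_Ico] at hi hk
  obtain rfl := ht.eq_of_mem (by omega) (by omega) (hV hiV) (hW hkW)
  exact Set.disjoint_left.1 hVW hiV hkW

/-- A sequence of towers whose level unions approximate every measurable set. -/
structure IsGeneratingTowers (T : X ≃ᵐ X) (μ : Measure X) (B : ℕ → Set X) (h : ℕ → ℕ) :
    Prop where
  measurableSet : ∀ j, MeasurableSet (B j)
  isTower : ∀ j, IsTower T (B j) (h j)
  exists_approx : ∀ A : Set X, MeasurableSet A → ∃ J : ℕ → Set ℕ, (∀ j, ∀ i ∈ J j, i < h j) ∧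
    Tendsto (fun j => μ (symmDiff A (levelUnion T (B j) (J j)))) atTop (𝓝 0)

theorem IsGeneratingTowers.comp {T : X ≃ᵐ X} {μ : Measure X} {B : ℕ → Set X} {h : ℕ → ℕ}
    (hg : IsGeneratingTowers T μ B h) {s : ℕ → ℕ} (hs : Tendsto s atTop atTop) :
    IsGeneratingTowers T μ (fun j => B (s j)) (fun j => h (s j)) where
  measurableSet j := hg.measurableSet _
  isTower j := hg.isTower _
  exists_approx A hA := by
    obtain ⟨J, hJ, hlim⟩ := hg.exists_approx A hA
    exact ⟨fun j => J (s j), fun j => hJ (s j), hlim.comp hs⟩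

theorem IsGeneratingTowers.exists_approx_real {T : X ≃ᵐ X} {μ : Measure X} [IsFiniteMeasure μ]
    {B : ℕ → Set X} {h : ℕ → ℕ} (hg : IsGeneratingTowers T μ B h) {A : Set X}
    (hA : MeasurableSet A) : ∃ J : ℕ → Set ℕ, (∀ j, ∀ i ∈ J j, i < h j) ∧
      Tendsto (fun j => μ.real (symmDiff A (levelUnion T (B j) (J j)))) atTop (𝓝 0) := by
  obtain ⟨J, hJ, hlim⟩ := hg.exists_approx A hA
  refine ⟨J, hJ, ?_⟩
  exact (ENNReal.tendsto_toReal ENNReal.zero_ne_top).comp hlim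

/-- The tower over `W j` is asymptotically independent of every fixed set. It suffices to
approximate `E` by levels; the truncation costs nothing in the limit because the heights tend to
infinity and hence the base measures to zero. -/
theorem IsGeneratingTowers.tendsto_inter_innerTower {T : X ≃ᵐ X} {μ : Measure X}
    [IsProbabilityMeasure μ] (hT : MeasurePreserving T μ μ) {B : ℕ → Set X} {h : ℕ → ℕ}
    (hg : IsGeneratingTowers T μ B h) (hh : Tendsto h atTop atTop) {W : ℕ → Set X}
    (hWm : ∀ j, MeasurableSet (W j)) (hW : ∀ j, W j ⊆ B j) {w : ℝ}
    (hw : Tendsto (fun j => μ.real (W j) / μ.real (B j)) atTop (𝓝 w)) (L : ℕ) {E : Set X}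
    (hE : MeasurableSet E) :
    Tendsto (fun j => μ.real (E ∩ innerTower T (W j) (h j) L)) atTop (𝓝 (w * μ.real E)) := by
  classical
  obtain ⟨J, hJ, hlim⟩ := hg.exists_approx_real (μ := μ) hE
  have hB0 : Tendsto (fun j => μ.real (B j)) atTop (𝓝 0) := by
    have hinv : Tendsto (fun j => ((h j : ℝ))⁻¹) atTop (𝓝 0) :=
      tendsto_inv_atTop_zero.comp (tendsto_natCast_atTop_atTop.comp hh)
    refine squeeze_zero' (.of_forall fun j => measureReal_nonneg) ?_ hinv
    filter_upwards [hh.eventually_gt_atTop 0] with j hj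
    have := (hg.isTower j).height_mul_measureReal_le_one hT (hg.measurableSet j)
    rw [← one_div, le_div_iff₀ (by exact_mod_cast hj), mul_comm]
    exact this
  rw [tendsto_iff_dist_tendsto_zero]
  have hbound : Tendsto (fun j => μ.real (symmDiff E (levelUnion T (B j) (J j)))
      + (|μ.real (W j) / μ.real (B j) - w| + |w| * (2 * L * μ.real (B j)))
      + |w| * μ.real (symmDiff E (levelUnion T (B j) (J j)))) atTop (𝓝 0) := by
    have h1 := (hw.sub_const w).abs
    have h2 := (hB0.const_mul (2 * L : ℝ)).const_mul |w|
    have h3 := (hlim.add (h1.add h2)).add (hlim.const_mul |w|)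
    simpa using h3
  refine squeeze_zero (fun j => dist_nonneg) (fun j => ?_) hbound
  obtain ⟨S, hS⟩ : ∃ S : Finset ℕ, (S : Set ℕ) = J j :=
    ⟨(Finset.range (h j)).filter (· ∈ J j), by
      ext i; simpa using fun hi => hJ j i hi⟩
  rw [← hS, Real.dist_eq]
  set E' := levelUnion T (B j) S
  set G := innerTower T (W j) (h j) L
  have e1 : |μ.real (E ∩ G) - μ.real (E' ∩ G)| ≤ μ.real (symmDiff E E') := by
    refine (abs_measureReal_sub_le_symmDiff _ _).trans (measureReal_mono ?_)
    rintro x (⟨⟨h1, h2⟩, h3⟩ | ⟨⟨h1, h2⟩, h3⟩)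
    · exact .inl ⟨h1, fun h4 => h3 ⟨h4, h2⟩⟩
    · exact .inr ⟨h1, fun h4 => h3 ⟨h4, h2⟩⟩
  have e2 := (hg.isTower j).abs_measureReal_inter_innerTower_sub_le hT (hg.measurableSet j)
    (hWm j) (hW j) S (fun i hi => hJ j i (hS ▸ hi)) L w
  have e3 : |w * μ.real E' - w * μ.real E| ≤ |w| * μ.real (symmDiff E E') := by
    rw [← mul_sub, abs_mul, abs_sub_comm]
    exact mul_le_mul_of_nonneg_left (abs_measureReal_sub_le_symmDiff _ _) (abs_nonneg _)
  calc |μ.real (E ∩ G) - w * μ.real E|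
      = |(μ.real (E ∩ G) - μ.real (E' ∩ G)) + (μ.real (E' ∩ G) - w * μ.real E')
          + (w * μ.real E' - w * μ.real E)| := by congr 1; ring
    _ ≤ _ := (abs_add_three _ _ _).trans (add_le_add (add_le_add e1 e2) e3)

/-- If parts `W j c` of the bases of a generating sequence of towers, of asymptotic proportions
`w c`, are moved by `T ^ (-(u j - α c))` and `T ^ (-(v j - β c))` into the base, then
`T ^ u j` and `T ^ v j` act asymptotically as `T ^ α c` and `T ^ β c` with weight `w c`. -/
theorem IsGeneratingTowers.tendsto_triple {T : X ≃ᵐ X} {μ : Measure X}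
    [IsProbabilityMeasure μ] (hT : MeasurePreserving T μ μ) {B : ℕ → Set X} {h : ℕ → ℕ}
    (hg : IsGeneratingTowers T μ B h) (hh : Tendsto h atTop atTop) {ι : Type*} [Fintype ι]
    {W : ℕ → ι → Set X} (hWm : ∀ j c, MeasurableSet (W j c)) (hW : ∀ j c, W j c ⊆ B j)
    (hWd : ∀ j c d, c ≠ d → Disjoint (W j c) (W j d)) {w : ι → ℝ}
    (hw : ∀ c, Tendsto (fun j => μ.real (W j c) / μ.real (B j)) atTop (𝓝 (w c)))
    (hw1 : ∑ c, w c = 1) {u v : ℕ → ℤ} {α β : ι → ℤ} {L : ℕ} (hα : ∀ c, |α c| ≤ L)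
    (hβ : ∀ c, |β c| ≤ L) (hu : ∀ j c, ∀ x ∈ W j c, zpowMap T (-(u j - α c)) x ∈ B j)
    (hv : ∀ j c, ∀ x ∈ W j c, zpowMap T (-(v j - β c)) x ∈ B j)
    {A₁ A₂ A₃ : Set X} (h₁ : MeasurableSet A₁) (h₂ : MeasurableSet A₂) (h₃ : MeasurableSet A₃) :
    Tendsto (fun j => μ.real (A₁ ∩ powImage T (u j) A₂ ∩ powImage T (v j) A₃)) atTop
      (𝓝 (∑ c, w c * μ.real (A₁ ∩ powImage T (α c) A₂ ∩ powImage T (β c) A₃))) := by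
  classical
  set G : ℕ → ι → Set X := fun j c => innerTower T (W j c) (h j) L with hG
  set R : ι → Set X := fun c => A₁ ∩ powImage T (α c) A₂ ∩ powImage T (β c) A₃ with hR
  have hGm : ∀ j c, MeasurableSet (G j c) := fun j c => measurableSet_levelUnion T (hWm j c) _
  have hGd : ∀ j, Pairwise (Function.onFun Disjoint (G j)) := fun j c d hcd =>
    (hg.isTower j).disjoint_innerTower (hW j c) (hW j d) (hWd j c d hcd) L
  have hRm : ∀ c, MeasurableSet (R c) := fun c =>
    (h₁.inter (measurableSet_powImage T _ h₂)).inter (measurableSet_powImage T _ h₃)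
  have hlim : Tendsto (fun j => ∑ c, μ.real (R c ∩ G j c)) atTop
      (𝓝 (∑ c, w c * μ.real (R c))) :=
    tendsto_finsetSum _ fun c _ =>
      hg.tendsto_inter_innerTower hT hh (fun j => hWm j c) (fun j => hW j c) (hw c) L (hRm c)
  -- The weights sum to one, so the inner towers together exhaust the space in measure.
  have hrest : Tendsto (fun j => 1 - ∑ c, μ.real (G j c)) atTop (𝓝 0) := by
    have : Tendsto (fun j => ∑ c, μ.real (Set.univ ∩ G j c)) atTop
        (𝓝 (∑ c, w c * μ.real Set.univ)) :=
      tendsto_finsetSum _ fun c _ =>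
        hg.tendsto_inter_innerTower hT hh (fun j => hWm j c) (fun j => hW j c) (hw c) L .univ
    simpa [hw1] using this.const_sub 1
  obtain ⟨J₂, hJ₂, hl₂⟩ := hg.exists_approx_real (μ := μ) h₂
  obtain ⟨J₃, hJ₃, hl₃⟩ := hg.exists_approx_real (μ := μ) h₃
  set δ : ℕ → ℝ := fun j => μ.real (symmDiff A₂ (levelUnion T (B j) (J₂ j)))
  set η : ℕ → ℝ := fun j => μ.real (symmDiff A₃ (levelUnion T (B j) (J₃ j)))
  set S : ℕ → Set X := fun j => A₁ ∩ powImage T (u j) A₂ ∩ powImage T (v j) A₃ with hS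
  have hSm : ∀ j, MeasurableSet (S j) := fun j =>
    (h₁.inter (measurableSet_powImage T _ h₂)).inter (measurableSet_powImage T _ h₃)
  have hclose : ∀ j c, |μ.real (S j ∩ G j c) - μ.real (R c ∩ G j c)| ≤
      δ j + δ j + η j + η j := by
    intro j c
    refine (abs_measureReal_sub_le_symmDiff _ _).trans ?_
    have hD₂ : MeasurableSet (symmDiff A₂ (levelUnion T (B j) (J₂ j))) :=
      h₂.symmDiff (measurableSet_levelUnion T (hg.measurableSet j) _)
    have hD₃ : MeasurableSet (symmDiff A₃ (levelUnion T (B j) (J₃ j))) :=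
      h₃.symmDiff (measurableSet_levelUnion T (hg.measurableSet j) _)
    have hmeas : ∀ k, ∀ D : Set X, MeasurableSet D → μ.real (powImage T k D) = μ.real D :=
      fun k D hD => by rw [measureReal_def, measure_powImage hT k hD, measureReal_def]
    -- Inside `G j c` the two conditions agree for level unions. A discrepancy can therefore come
    -- only from one of the four translated approximation errors.
    have hsub : symmDiff (S j ∩ G j c) (R c ∩ G j c) ⊆
        powImage T (u j) (symmDiff A₂ (levelUnion T (B j) (J₂ j))) ∪
        powImage T (α c) (symmDiff A₂ (levelUnion T (B j) (J₂ j))) ∪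
        powImage T (v j) (symmDiff A₃ (levelUnion T (B j) (J₃ j))) ∪
        powImage T (β c) (symmDiff A₃ (levelUnion T (B j) (J₃ j))) := by
      intro y hy
      have hyG : y ∈ G j c := by
        rcases hy with hy | hy
        · exact hy.1.2
        · exact hy.1.2
      have k₂ := mem_powImage_levelUnion_iff_of_mem_innerTower (hg.isTower j) (hW j c) (hJ₂ j)
        (hα c) (hu j c) hyG
      have k₃ := mem_powImage_levelUnion_iff_of_mem_innerTower (hg.isTower j) (hW j c) (hJ₃ j)
        (hβ c) (hv j c) hyG
      by_contra hn
      simp only [Set.mem_union, mem_powImage, Set.mem_symmDiff, hS, hR, Set.mem_inter_iff] at *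
      tauto
    refine (measureReal_mono hsub).trans ?_
    refine (measureReal_union_le _ _).trans (add_le_add ?_ (hmeas _ _ hD₃).le)
    refine (measureReal_union_le _ _).trans (add_le_add ?_ (hmeas _ _ hD₃).le)
    exact (measureReal_union_le _ _).trans (add_le_add (hmeas _ _ hD₂).le (hmeas _ _ hD₂).le)
  have hsplit : ∀ j, |μ.real (S j) - ∑ c, μ.real (S j ∩ G j c)| ≤
      1 - ∑ c, μ.real (G j c) := by
    intro j
    have hU : MeasurableSet (⋃ c, G j c) := MeasurableSet.iUnion (hGm j)
    have e1 : ∑ c, μ.real (S j ∩ G j c) = μ.real (S j ∩ ⋃ c, G j c) := by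
      rw [Set.inter_iUnion, measureReal_iUnion_fintype
        (fun c d hcd => (hGd j hcd).mono Set.inter_subset_right Set.inter_subset_right)
        fun c => (hSm j).inter (hGm j c)]
    have e2 : ∑ c, μ.real (G j c) = μ.real (⋃ c, G j c) := by
      rw [measureReal_iUnion_fintype (hGd j) (hGm j)]
    have e3 := measureReal_inter_add_sdiff (μ := μ) (s := S j) hU
    have e4 : μ.real (S j \ ⋃ c, G j c) ≤ 1 - μ.real (⋃ c, G j c) := by
      rw [← probReal_compl_eq_one_sub hU]
      exact measureReal_mono fun x hx => hx.2
    rw [e1, e2, abs_of_nonneg (by linarith [measureReal_nonneg (μ := μ) (s := S j \ ⋃ c, G j c)])]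
    linarith
  have hfinal : Tendsto (fun j => μ.real (S j) - ∑ c, μ.real (R c ∩ G j c)) atTop (𝓝 0) := by
    have hb : Tendsto (fun j => (1 - ∑ c, μ.real (G j c)) +
        ∑ _c : ι, (δ j + δ j + η j + η j)) atTop (𝓝 0) := by
      have := hrest.add (tendsto_finsetSum (Finset.univ : Finset ι) fun c _ =>
        ((hl₂.add hl₂).add hl₃).add hl₃)
      simpa using this
    refine squeeze_zero_norm (fun j => ?_) hb
    have e : μ.real (S j) - ∑ c, μ.real (R c ∩ G j c) =
        (μ.real (S j) - ∑ c, μ.real (S j ∩ G j c)) +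
          ∑ c, (μ.real (S j ∩ G j c) - μ.real (R c ∩ G j c)) := by
      rw [Finset.sum_sub_distrib]; ring
    rw [Real.norm_eq_abs, e]
    refine (abs_add_le _ _).trans (add_le_add (hsplit j) ?_)
    exact (Finset.abs_sum_le_sum_abs _ _).trans (Finset.sum_le_sum fun c _ => hclose j c)
  simpa using hfinal.add hlim

end Towers

/-! ### The σ-algebra of sets approximable by levels. -/

section ApproximationClass

variable {X : Type*} [MeasurableSpace X]

/-- Sets that are approximated in measure by unions of levels of the towers over `B j`. -/
def IsTowerApproximable (T : X ≃ᵐ X) (μ : Measure X) (B : ℕ → Set X) (h : ℕ → ℕ) (A : Set X) :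
    Prop :=
  ∀ ε : ENNReal, 0 < ε → ∀ᶠ j in atTop, ∃ J : Set ℕ, (∀ i ∈ J, i < h j) ∧
    μ (symmDiff A (levelUnion T (B j) J)) ≤ ε

variable {T : X ≃ᵐ X} {μ : Measure X} {B : ℕ → Set X} {h : ℕ → ℕ}

/-- A tower has finitely many level unions, so a best one can be chosen for each `j`; a single
sequence then serves every `ε`. -/
theorem IsTowerApproximable.exists_tendsto [IsFiniteMeasure μ] {A : Set X}
    (hA : IsTowerApproximable T μ B h A) :
    ∃ J : ℕ → Set ℕ, (∀ j, ∀ i ∈ J j, i < h j) ∧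
      Tendsto (fun j => μ (symmDiff A (levelUnion T (B j) (J j)))) atTop (𝓝 0) := by
  have key : ∀ j : ℕ, ∃ J : Set ℕ, (∀ i ∈ J, i < h j) ∧ ∀ J' : Set ℕ, (∀ i ∈ J', i < h j) →
      μ (symmDiff A (levelUnion T (B j) J)) ≤ μ (symmDiff A (levelUnion T (B j) J')) := by
    intro j
    have hfin : {J : Set ℕ | ∀ i ∈ J, i < h j}.Finite :=
      (Set.finite_Iio (h j)).finite_subsets.subset fun J hJ i hi => hJ i hi
    obtain ⟨J, hJ, hmin⟩ := Set.exists_min_image _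
      (fun J => μ (symmDiff A (levelUnion T (B j) J))) hfin ⟨∅, fun i hi => hi.elim⟩
    exact ⟨J, hJ, hmin⟩
  choose J hJ hmin using key
  refine ⟨J, hJ, ENNReal.tendsto_nhds_zero.2 fun ε hε => ?_⟩
  filter_upwards [hA ε hε] with j ⟨J', hJ', hle⟩
  exact (hmin j J' hJ').trans hle

/-- The complementary set of levels works up to the part of the space outside the tower, which is
why the towers must fill the space in the limit. -/
theorem IsTowerApproximable.compl (ht : ∀ j, IsTower T (B j) (h j))
    (hfull : Tendsto (fun j => μ (levelUnion T (B j) (Set.Iio (h j)))ᶜ) atTop (𝓝 0)) {A : Set X}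
    (hA : IsTowerApproximable T μ B h A) : IsTowerApproximable T μ B h Aᶜ := by
  intro ε hε
  have hε2 : 0 < ε / 2 := ENNReal.half_pos hε.ne'
  filter_upwards [hA _ hε2, ENNReal.tendsto_nhds_zero.1 hfull _ hε2] with j ⟨J, hJ, hle⟩ hj
  refine ⟨Set.Iio (h j) \ J, fun i hi => hi.1, ?_⟩
  refine (measure_mono (t := symmDiff A (levelUnion T (B j) J) ∪
    (levelUnion T (B j) (Set.Iio (h j)))ᶜ) ?_).trans
    ((measure_union_le _ _).trans ((add_le_add hle hj).trans (ENNReal.add_halves ε).le))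
  intro y hy
  by_contra hn
  simp only [Set.mem_union, Set.mem_compl_iff, not_or, not_not] at hn
  obtain ⟨hn1, hn2⟩ := hn
  obtain ⟨m, hm, hmB⟩ := mem_levelUnion.1 hn2
  have e : y = zpowMap T m (zpowMap T (-(m : ℤ)) y) := (zpowMap_apply_neg_self T m y).symm
  have k1 := (ht j).mem_levelUnion_iff hJ hm hmB
  have k2 := (ht j).mem_levelUnion_iff (J := Set.Iio (h j) \ J) (fun i hi => hi.1) hm hmB
  rw [← e] at k1 k2
  simp only [Set.mem_symmDiff, Set.mem_compl_iff, k1, k2, Set.mem_sdiff, Set.mem_Iio] at *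
  tauto

theorem IsTowerApproximable.union {A A' : Set X} (hA : IsTowerApproximable T μ B h A)
    (hA' : IsTowerApproximable T μ B h A') : IsTowerApproximable T μ B h (A ∪ A') := by
  intro ε hε
  have hε2 : 0 < ε / 2 := ENNReal.half_pos hε.ne'
  filter_upwards [hA _ hε2, hA' _ hε2] with j ⟨J, hJ, hle⟩ ⟨J', hJ', hle'⟩
  refine ⟨J ∪ J', fun i hi => hi.elim (hJ i) (hJ' i), ?_⟩
  have hu : levelUnion T (B j) (J ∪ J') = levelUnion T (B j) J ∪ levelUnion T (B j) J' :=
    Set.biUnion_union _ _ _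
  rw [hu]
  refine (measure_mono (t := symmDiff A (levelUnion T (B j) J) ∪
    symmDiff A' (levelUnion T (B j) J')) ?_).trans
    ((measure_union_le _ _).trans ((add_le_add hle hle').trans (ENNReal.add_halves ε).le))
  intro y hy
  simp only [Set.mem_symmDiff, Set.mem_union] at *
  tauto

theorem isTowerApproximable_empty : IsTowerApproximable T μ B h ∅ := fun ε _ =>
  .of_forall fun j => ⟨∅, fun i hi => hi.elim, by simp [levelUnion]⟩

/-- By continuity of the finite measure, a finite subunion already carries all but `ε / 2`. -/
theorem IsTowerApproximable.iUnion [IsFiniteMeasure μ] {A : ℕ → Set X}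
    (hm : ∀ n, MeasurableSet (A n))
    (hA : ∀ n, IsTowerApproximable T μ B h (A n)) :
    IsTowerApproximable T μ B h (⋃ n, A n) := by
  intro ε hε
  have hε2 : 0 < ε / 2 := ENNReal.half_pos hε.ne'
  have hacc : ∀ n, IsTowerApproximable T μ B h (Set.accumulate A n) := by
    intro n
    induction n with
    | zero => simpa [Set.accumulate_zero_nat] using hA 0
    | succ n ih => rw [Set.accumulate_succ]; exact ih.union (hA _)
  have hlim : Tendsto (fun n => μ ((⋃ n, A n) \ Set.accumulate A n)) atTop (𝓝 0) := by
    have hanti : Antitone fun n => (⋃ n, A n) \ Set.accumulate A n := fun a b hab =>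
      Set.sdiff_subset_sdiff_right (Set.monotone_accumulate hab)
    have hacm : ∀ n, MeasurableSet (Set.accumulate A n) := fun n =>
      .biUnion (Set.to_countable _) fun k _ => hm k
    have := tendsto_measure_iInter_atTop (μ := μ)
      (fun n => ((MeasurableSet.iUnion hm).diff (hacm n)).nullMeasurableSet)
      hanti ⟨0, measure_ne_top _ _⟩
    rwa [← Set.sdiff_iUnion, Set.iUnion_accumulate, Set.sdiff_self, measure_empty] at this
  obtain ⟨n, hn⟩ := (ENNReal.tendsto_nhds_zero.1 hlim _ hε2).exists
  filter_upwards [hacc n _ hε2] with j ⟨J, hJ, hle⟩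
  refine ⟨J, hJ, ?_⟩
  refine (measure_mono (t := ((⋃ n, A n) \ Set.accumulate A n) ∪
    symmDiff (Set.accumulate A n) (levelUnion T (B j) J)) ?_).trans
    ((measure_union_le _ _).trans ((add_le_add hn hle).trans (ENNReal.add_halves ε).le))
  have hsub := Set.accumulate_subset_iUnion (s := A) n
  intro y hy
  have := @hsub y
  simp only [Set.mem_symmDiff, Set.mem_union, Set.mem_sdiff] at *
  tauto

/-- The σ-algebra of measurable sets approximated by unions of levels. -/
abbrev towerApproximableSpace [IsFiniteMeasure μ] (ht : ∀ j, IsTower T (B j) (h j))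
    (hfull : Tendsto (fun j => μ (levelUnion T (B j) (Set.Iio (h j)))ᶜ) atTop (𝓝 0)) :
    MeasurableSpace X where
  MeasurableSet' A := MeasurableSet A ∧ IsTowerApproximable T μ B h A
  measurableSet_empty := ⟨.empty, isTowerApproximable_empty⟩
  measurableSet_compl _ hA := ⟨hA.1.compl, hA.2.compl ht hfull⟩
  measurableSet_iUnion _ hA := ⟨.iUnion fun n => (hA n).1, .iUnion (fun n => (hA n).1)
    fun n => (hA n).2⟩

end ApproximationClass

/-! ### The 2-adic odometer and its Haar measure. -/

section TwoAdic

noncomputable instance : MeasurableSpace ℤ_[2] := borel _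
instance : BorelSpace ℤ_[2] := ⟨rfl⟩

/-- The residue class of a 2-adic integer modulo `2 ^ n`. -/
noncomputable abbrev res (n : ℕ) : ℤ_[2] →+* ZMod (2 ^ n) := PadicInt.toZModPow n

theorem res_eq_of_le {m n : ℕ} (h : m ≤ n) {x y : ℤ_[2]} (hxy : res n x = res n y) :
    res m x = res m y := by
  rw [← PadicInt.cast_toZModPow m n h, ← PadicInt.cast_toZModPow m n h, hxy]

theorem res_eq_zero_of_le {m n : ℕ} (h : m ≤ n) {x : ℤ_[2]} (hx : res n x = 0) :
    res m x = 0 := by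
  rw [← map_zero (res m)]
  exact res_eq_of_le h (by rw [hx, map_zero])

theorem setOf_res_eq_zero (n : ℕ) :
    {x : ℤ_[2] | res n x = 0} = Metric.closedBall 0 ((2 : ℝ) ^ (-n : ℤ)) := by
  ext x
  rw [mem_closedBall_zero_iff]
  have := PadicInt.norm_le_pow_iff_mem_span_pow x n
  rw [← PadicInt.ker_toZModPow, RingHom.mem_ker] at this
  exact_mod_cast this.symm

theorem isOpen_res_fiber (n : ℕ) (a : ZMod (2 ^ n)) : IsOpen {x : ℤ_[2] | res n x = a} := by
  have h0 : IsOpen {x : ℤ_[2] | res n x = 0} := by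
    rw [setOf_res_eq_zero]
    exact IsUltrametricDist.isOpen_closedBall _ (by positivity)
  have : {x : ℤ_[2] | res n x = a} = (fun x => x - (a.val : ℤ_[2])) ⁻¹' {x | res n x = 0} := by
    ext x
    simp [sub_eq_zero]
  rw [this]
  exact h0.preimage (by fun_prop)

theorem measurable_res (n : ℕ) : Measurable[_, ⊤] (res n) := by
  let : MeasurableSpace (ZMod (2 ^ n)) := ⊤
  exact measurable_to_countable' fun a => (isOpen_res_fiber n a).measurableSet

/-- Residue classes are balls with arbitrarily small radii, so they form a basis of the topology. -/
theorem borel_le_of_res_fiber (m : MeasurableSpace ℤ_[2])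
    (h : ∀ n a, MeasurableSet[m] {x : ℤ_[2] | res n x = a}) : borel ℤ_[2] ≤ m := by
  have hb : TopologicalSpace.IsTopologicalBasis {s : Set ℤ_[2] | ∃ n a, s = {x | res n x = a}} := by
    refine TopologicalSpace.isTopologicalBasis_of_isOpen_of_nhds ?_ ?_
    · rintro _ ⟨n, a, rfl⟩
      exact isOpen_res_fiber n a
    · intro a u ha hu
      obtain ⟨ε, hε, hsub⟩ := Metric.isOpen_iff.1 hu a ha
      obtain ⟨n, hn⟩ := PadicInt.exists_pow_neg_lt 2 hε
      refine ⟨_, ⟨n, res n a, rfl⟩, rfl, fun x hx => hsub ?_⟩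
      have hx' : x - a ∈ {x : ℤ_[2] | res n x = 0} := by
        simpa [sub_eq_zero] using hx
      rw [setOf_res_eq_zero, mem_closedBall_zero_iff] at hx'
      rw [Metric.mem_ball, dist_eq_norm]
      exact hx'.trans_lt (by exact_mod_cast hn)
  rw [hb.borel_eq_generateFrom]
  refine MeasurableSpace.generateFrom_le ?_
  rintro _ ⟨n, a, rfl⟩
  exact h n a

/-- The Haar probability measure of the 2-adic integers. -/
noncomputable def haarTwo : Measure ℤ_[2] := Measure.addHaarMeasure ⊤

instance : haarTwo.IsAddHaarMeasure := by unfold haarTwo; infer_instance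

instance : IsProbabilityMeasure haarTwo := ⟨by
  have := Measure.addHaarMeasure_self (K₀ := (⊤ : TopologicalSpace.PositiveCompacts ℤ_[2]))
  simpa [haarTwo] using this⟩

theorem measurePreserving_add_one : MeasurePreserving (fun x : ℤ_[2] => x + 1) haarTwo haarTwo :=
  measurePreserving_add_right haarTwo 1

theorem ergodic_add_one : Ergodic (fun x : ℤ_[2] => x + 1) haarTwo := by
  -- The odometer is the translation by 1, whose multiples, the integers, are dense.
  have h := ergodic_add_left_of_denseRange_zsmul (g := (1 : ℤ_[2]))
    (by simpa using PadicInt.denseRange_intCast (p := 2)) haarTwo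
  simpa [add_comm] using h

theorem haarTwo_res_fiber_eq (n : ℕ) (a : ZMod (2 ^ n)) :
    haarTwo {x | res n x = a} = haarTwo {x | res n x = 0} := by
  have : {x : ℤ_[2] | res n x = a} = (fun x => x + (-(a.val : ℤ_[2]))) ⁻¹' {x | res n x = 0} := by
    ext x
    simp [← sub_eq_add_neg, sub_eq_zero]
  rw [this]
  exact measure_preimage_add_right _ _ _

theorem haarTwo_res_fiber (n : ℕ) (a : ZMod (2 ^ n)) :
    haarTwo.real {x | res n x = a} = (2 ^ n : ℝ)⁻¹ := by
  have h1 : ∀ a : ZMod (2 ^ n), haarTwo.real {x | res n x = a} = haarTwo.real {x | res n x = 0} :=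
    fun a => by rw [measureReal_def, haarTwo_res_fiber_eq, measureReal_def]
  have hU : ⋃ a : ZMod (2 ^ n), {x : ℤ_[2] | res n x = a} = Set.univ := by
    ext x; simp
  have := measureReal_iUnion_fintype (μ := haarTwo) (f := fun a : ZMod (2 ^ n) => {x | res n x = a})
    (fun a b hab => Set.disjoint_left.2 fun x hx hx' => hab (hx.symm.trans hx'))
    fun a => (isOpen_res_fiber n a).measurableSet
  rw [hU, Finset.sum_congr rfl fun a _ => h1 a] at this
  simp only [probReal_univ, Finset.sum_const, Finset.card_univ, ZMod.card, nsmul_eq_mul] at this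
  push_cast at this
  rw [h1]
  exact eq_inv_of_mul_eq_one_right this.symm

instance : NullSingletonClass haarTwo := ⟨fun x => by
  have h : ∀ n, haarTwo.real {x} ≤ (2⁻¹ : ℝ) ^ n := fun n => by
    rw [inv_pow, ← haarTwo_res_fiber n (res n x)]
    exact measureReal_mono fun y hy => by rw [Set.mem_singleton_iff.1 hy]; rfl
  have h0 : haarTwo.real {x} = 0 := le_antisymm
    (ge_of_tendsto' (tendsto_pow_atTop_nhds_zero_of_lt_one (by norm_num) (by norm_num)) h)
    measureReal_nonneg
  exact (measureReal_eq_zero_iff (by finiteness)).1 h0⟩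

end TwoAdic

/-! ### Suspensions of the odometer: invariant measure and ergodicity. -/

section Suspension

/-- The suspension of the 2-adic odometer `x ↦ x + 1` with roof function `φ`, acting on
`{(x, i) | i < φ x}` and extended by the identity. -/
noncomputable def suspFun (φ : ℤ_[2] → ℕ) (p : ℤ_[2] × ℕ) : ℤ_[2] × ℕ :=
  if p.2 + 1 < φ p.1 then (p.1, p.2 + 1) else if p.2 + 1 = φ p.1 then (p.1 + 1, 0) else p

/-- The inverse of `suspFun`. -/
noncomputable def suspInv (φ : ℤ_[2] → ℕ) (p : ℤ_[2] × ℕ) : ℤ_[2] × ℕ :=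
  if φ p.1 ≤ p.2 then p else if p.2 = 0 then (p.1 - 1, φ (p.1 - 1) - 1) else (p.1, p.2 - 1)

variable {φ : ℤ_[2] → ℕ}

theorem suspInv_suspFun (hφ : ∀ x, 0 < φ x) (p : ℤ_[2] × ℕ) : suspInv φ (suspFun φ p) = p := by
  obtain ⟨x, i⟩ := p
  by_cases h1 : i + 1 < φ x
  · have h2 : ¬ φ x ≤ i + 1 := by omega
    simp [suspFun, suspInv, h1, h2]
  · by_cases h2 : i + 1 = φ x
    · have h3 : ¬ φ (x + 1) ≤ 0 := by have := hφ (x + 1); omega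
      simp [suspFun, suspInv, ← h2]
      intro h; rw [h] at h3; simp at h3
    · have h3 : φ x ≤ i := by omega
      simp [suspFun, suspInv, h1, h2, h3]

theorem suspFun_suspInv (hφ : ∀ x, 0 < φ x) (p : ℤ_[2] × ℕ) : suspFun φ (suspInv φ p) = p := by
  obtain ⟨x, i⟩ := p
  by_cases h1 : φ x ≤ i
  · have h2 : ¬ i + 1 < φ x := by omega
    have h3 : ¬ i + 1 = φ x := by omega
    simp [suspFun, suspInv, h1, h2, h3]
  · by_cases h2 : i = 0
    · have h3 : φ (x - 1) - 1 + 1 = φ (x - 1) := by have := hφ (x - 1); omega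
      subst h2
      simp [suspFun, suspInv, h1, h3]
    · have h3 : i - 1 + 1 = i := by omega
      have h4 : i < φ x := by omega
      simp [suspFun, suspInv, h1, h2, h3, h4]

theorem measurable_suspFun (hm : Measurable φ) : Measurable (suspFun φ) := by
  have hφ1 : Measurable fun p : ℤ_[2] × ℕ => φ p.1 := hm.comp measurable_fst
  have h2 : Measurable fun p : ℤ_[2] × ℕ => p.2 + 1 := measurable_snd.add_const 1
  exact Measurable.ite (measurableSet_lt h2 hφ1) (measurable_fst.prodMk h2)
    (Measurable.ite (measurableSet_eq_fun h2 hφ1)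
      ((measurable_fst.add_const 1).prodMk measurable_const) measurable_id)

theorem measurable_suspInv (hm : Measurable φ) : Measurable (suspInv φ) := by
  have hφ1 : Measurable fun p : ℤ_[2] × ℕ => φ p.1 := hm.comp measurable_fst
  have hx : Measurable fun p : ℤ_[2] × ℕ => p.1 - 1 := measurable_fst.sub_const 1
  exact Measurable.ite (measurableSet_le hφ1 measurable_snd) measurable_id
    (Measurable.ite (measurableSet_eq_fun measurable_snd measurable_const)
      (hx.prodMk ((measurable_of_countable fun n : ℕ => n - 1).comp (hm.comp hx)))
      (measurable_fst.prodMk ((measurable_of_countable fun n : ℕ => n - 1).comp measurable_snd)))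

/-- The suspension as a measurable equivalence. -/
noncomputable def suspEquiv (hm : Measurable φ) (hφ : ∀ x, 0 < φ x) :
    ℤ_[2] × ℕ ≃ᵐ ℤ_[2] × ℕ where
  toFun := suspFun φ
  invFun := suspInv φ
  left_inv := suspInv_suspFun hφ
  right_inv := suspFun_suspInv hφ
  measurable_toFun := measurable_suspFun hm
  measurable_invFun := measurable_suspInv hm

/-- The unnormalised invariant measure of the suspension. -/
noncomputable def suspMeasure (φ : ℤ_[2] → ℕ) : Measure (ℤ_[2] × ℕ) :=
  Measure.sum fun i => (haarTwo.restrict {x | i < φ x}).map fun x => (x, i)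

theorem suspMeasure_apply {A : Set (ℤ_[2] × ℕ)} (hA : MeasurableSet A) :
    suspMeasure φ A = ∑' i, haarTwo {x | i < φ x ∧ (x, i) ∈ A} := by
  rw [suspMeasure, Measure.sum_apply _ hA]
  refine tsum_congr fun i => ?_
  have h1 : Measurable fun x : ℤ_[2] => (x, i) := measurable_prodMk_right
  rw [Measure.map_apply h1 hA, Measure.restrict_apply (h1 hA)]
  congr 1
  ext x
  exact and_comm

theorem haarTwo_preimage_suspFun (hm : Measurable φ) {A : Set (ℤ_[2] × ℕ)}
    (hA : MeasurableSet A) (i : ℕ) :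
    haarTwo {x | i < φ x ∧ (x, i) ∈ suspFun φ ⁻¹' A} =
      haarTwo {x | i + 1 < φ x ∧ (x, i + 1) ∈ A} +
        haarTwo ({x | i + 1 = φ x} ∩ {x | (x + 1, 0) ∈ A}) := by
  have hi : MeasurableSet {x : ℤ_[2] | (x, 0) ∈ A} := measurable_prodMk_right hA
  have he : MeasurableSet {x | i + 1 = φ x} := measurableSet_eq_fun measurable_const hm
  have h0 : MeasurableSet {x : ℤ_[2] | (x + 1, 0) ∈ A} := measurable_add_const (1 : ℤ_[2]) hi
  rw [← measure_union _ (he.inter h0)]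
  · congr 1
    ext x
    simp only [Set.mem_ofPred_eq, Set.mem_preimage, suspFun, Set.mem_union, Set.mem_inter_iff]
    rcases lt_trichotomy (i + 1) (φ x) with h | h | h
    · simp [h, h.ne, (Nat.lt_succ_self i).trans h]
    · simp [← h]
    · have h1 : ¬ i < φ x := by omega
      have h2 : ¬ i + 1 < φ x := by omega
      have h3 : ¬ i + 1 = φ x := by omega
      simp [h1, h2, h3]
  · rw [Set.disjoint_left]
    rintro x ⟨h1, -⟩ ⟨h2, -⟩
    exact h1.ne h2

/-- The preimage at height `i` consists of a copy of level `i + 1` and of the points at the top of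
their fibre that move to the base. The tops partition the base, so their contributions add up to
level 0 by translation invariance. -/
theorem measurePreserving_suspFun (hm : Measurable φ) (hφ : ∀ x, 0 < φ x) :
    MeasurePreserving (suspFun φ) (suspMeasure φ) (suspMeasure φ) := by
  refine ⟨measurable_suspFun hm, Measure.ext fun A hA => ?_⟩
  have hi : ∀ i, MeasurableSet {x : ℤ_[2] | (x, i) ∈ A} := fun i => measurable_prodMk_right hA
  rw [Measure.map_apply (measurable_suspFun hm) hA,
    suspMeasure_apply (measurable_suspFun hm hA), suspMeasure_apply hA]
  have he : ∀ i : ℕ, MeasurableSet {x | i + 1 = φ x} := fun i =>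
    measurableSet_eq_fun measurable_const hm
  have h0 : MeasurableSet {x : ℤ_[2] | (x + 1, 0) ∈ A} := measurable_add_const (1 : ℤ_[2]) (hi 0)
  have hsplit := haarTwo_preimage_suspFun hm hA
  rw [tsum_congr hsplit]
  have hdis : Pairwise (Function.onFun Disjoint
      fun i => {x | i + 1 = φ x} ∩ {x : ℤ_[2] | (x + 1, 0) ∈ A}) := by
    intro i k hik
    rw [Function.onFun, Set.disjoint_left]
    rintro x ⟨h1, -⟩ ⟨h2, -⟩
    exact hik (Nat.succ_injective (h1.trans h2.symm))
  rw [ENNReal.tsum_add, ← measure_iUnion hdis fun i => (he i).inter h0, ← Set.iUnion_inter]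
  have hU : ⋃ i, {x | i + 1 = φ x} = Set.univ := by
    ext x
    simp only [Set.mem_iUnion, Set.mem_ofPred_eq, Set.mem_univ, iff_true]
    exact ⟨φ x - 1, by have := hφ x; omega⟩
  have hshift : haarTwo {x : ℤ_[2] | (x + 1, 0) ∈ A} = haarTwo {x : ℤ_[2] | (x, 0) ∈ A} := by
    rw [← measurePreserving_add_one.measure_preimage (hi 0).nullMeasurableSet,
      Set.preimage_ofPred_eq]
  have hsucc : ∑' i, haarTwo {x | i < φ x ∧ (x, i) ∈ A} =
      haarTwo {x | 0 < φ x ∧ (x, 0) ∈ A} + ∑' i, haarTwo {x | i + 1 < φ x ∧ (x, i + 1) ∈ A} :=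
    tsum_eq_zero_add' ENNReal.summable
  have hzero : {x : ℤ_[2] | 0 < φ x ∧ (x, 0) ∈ A} = {x | (x, 0) ∈ A} := by
    ext x
    simp only [Set.mem_ofPred_eq, hφ x, true_and]
  rw [hU, Set.univ_inter, hshift, hsucc, hzero, add_comm]

theorem suspFun_of_lt {x : ℤ_[2]} {i : ℕ} (h : i + 1 < φ x) : suspFun φ (x, i) = (x, i + 1) := by
  simp [suspFun, h]

theorem suspFun_of_eq {x : ℤ_[2]} {i : ℕ} (h : i + 1 = φ x) : suspFun φ (x, i) = (x + 1, 0) := by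
  simp [suspFun, h]

theorem suspFun_iterate_of_lt {x : ℤ_[2]} {i : ℕ} (h : i < φ x) :
    (suspFun φ)^[i] (x, 0) = (x, i) := by
  induction i with
  | zero => rfl
  | succ i ih =>
    rw [Function.iterate_succ_apply', ih (by omega), suspFun_of_lt h]

theorem suspFun_iterate_roof (hφ : ∀ x, 0 < φ x) (x : ℤ_[2]) :
    (suspFun φ)^[φ x] (x, 0) = (x + 1, 0) := by
  have := hφ x
  obtain ⟨i, hi⟩ : ∃ i, φ x = i + 1 := ⟨φ x - 1, by omega⟩
  rw [hi, Function.iterate_succ_apply', suspFun_iterate_of_lt (by omega), suspFun_of_eq hi.symm]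

theorem suspFun_iterate_sum (hφ : ∀ x, 0 < φ x) (x : ℤ_[2]) (n : ℕ) :
    (suspFun φ)^[∑ k ∈ Finset.range n, φ (x + k)] (x, 0) = (x + n, 0) := by
  induction n with
  | zero => simp
  | succ n ih =>
    rw [Finset.sum_range_succ, add_comm, Function.iterate_add_apply, ih,
      suspFun_iterate_roof hφ]
    push_cast
    rw [add_assoc]

/-- An invariant set is determined below the roof by its trace on the base, and that trace is
invariant under the odometer. -/
theorem ergodic_suspFun (hm : Measurable φ) (hφ : ∀ x, 0 < φ x) :
    Ergodic (suspFun φ) (suspMeasure φ) := by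
  refine ⟨measurePreserving_suspFun hm hφ, ⟨fun s hs hinv => ?_⟩⟩
  have hinv' : ∀ p, suspFun φ p ∈ s ↔ p ∈ s := fun p => by
    conv_rhs => rw [← hinv]
    rfl
  have hit : ∀ n p, (suspFun φ)^[n] p ∈ s ↔ p ∈ s := by
    intro n
    induction n with
    | zero => exact fun p => Iff.rfl
    | succ n ih => exact fun p => (ih _).trans (hinv' p)
  have hlev : ∀ x i, i < φ x → ((x, i) ∈ s ↔ (x, 0) ∈ s) := fun x i hi => by
    rw [← suspFun_iterate_of_lt hi, hit]
  have hbase : (fun x : ℤ_[2] => x + 1) ⁻¹' {x | (x, 0) ∈ s} = {x | (x, 0) ∈ s} := by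
    ext x
    rw [Set.mem_preimage, Set.mem_ofPred_eq, ← suspFun_iterate_roof hφ, hit]
    rfl
  have hms : MeasurableSet {x : ℤ_[2] | (x, 0) ∈ s} := measurable_prodMk_right hs
  have hnull : ∀ t : Set (ℤ_[2] × ℕ), MeasurableSet t →
      (∀ x i, i < φ x → (x, i) ∈ t → (x, 0) ∈ t) → haarTwo {x | (x, 0) ∈ t} = 0 →
      suspMeasure φ t = 0 := by
    intro t ht hl h0
    rw [suspMeasure_apply ht, ENNReal.tsum_eq_zero]
    exact fun i => measure_mono_null (fun x hx => hl x i hx.1 hx.2) h0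
  rw [eventuallyConst_set']
  rcases ergodic_add_one.toPreErgodic.ae_empty_or_univ hms hbase with h | h
  · left
    rw [ae_eq_empty] at h ⊢
    exact hnull s hs (fun x i hi => (hlev x i hi).1) h
  · right
    rw [ae_eq_univ] at h ⊢
    exact hnull sᶜ hs.compl (fun x i hi hx h0 => hx ((hlev x i hi).2 h0)) h

theorem suspMeasure_singleton (φ : ℤ_[2] → ℕ) (p : ℤ_[2] × ℕ) : suspMeasure φ {p} = 0 := by
  rw [suspMeasure_apply (measurableSet_singleton p), ENNReal.tsum_eq_zero]
  refine fun i => measure_mono_null (t := {p.1}) (fun x hx => ?_) (measure_singleton _)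
  exact congrArg Prod.fst hx.2

theorem suspMeasure_prod_zero (hφ : ∀ x, 0 < φ x) {V : Set ℤ_[2]}
    (hV : MeasurableSet V) : suspMeasure φ (V ×ˢ {0}) = haarTwo V := by
  rw [suspMeasure_apply (hV.prod (measurableSet_singleton 0)), tsum_eq_single 0]
  · simp [hφ]
  · intro i hi
    simp [hi]

theorem suspMeasure_univ (φ : ℤ_[2] → ℕ) :
    suspMeasure φ Set.univ = ∑' i, haarTwo {x | i < φ x} := by
  rw [suspMeasure_apply .univ]
  simp

theorem suspMeasure_setOf_le (hm : Measurable φ) : suspMeasure φ {p | φ p.1 ≤ p.2} = 0 := by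
  have hs : MeasurableSet {p : ℤ_[2] × ℕ | φ p.1 ≤ p.2} :=
    measurableSet_le (hm.comp measurable_fst) measurable_snd
  rw [suspMeasure_apply hs, ENNReal.tsum_eq_zero]
  intro i
  convert measure_empty (μ := haarTwo)
  ext x
  simp only [Set.mem_ofPred_eq, Set.mem_empty_iff_false, iff_false]
  omega

end Suspension

/-! ### The roof function and its integrability. -/

section Roof

/-- The base of the `j`-th tower lies over the residue class of `0` modulo `2 ^ towerExp j`. -/
def towerExp (j : ℕ) : ℕ := 4 * j ^ 2

/-- The spacer unit at the `j`-th stage; it takes every positive value infinitely often. -/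
def spacerUnit (j : ℕ) : ℕ := (Nat.unpair j).1 + 1

/-- The number of spacers above the `q`-th column of the `j`-th tower. -/
def columnSpacer (j q : ℕ) : ℕ := spacerUnit j * (2 - q % 3)

/-- The stage at which the point above `x` is the top of a column. -/
noncomputable def stage (x : ℤ_[2]) : ℕ := sInf {j | res (towerExp (j + 1)) (x + 1) ≠ 0}

/-- The roof function of the rank-one construction. -/
noncomputable def roof (x : ℤ_[2]) : ℕ :=
  1 + columnSpacer (stage x)
    ((res (towerExp (stage x + 1)) (x + 1)).val / 2 ^ towerExp (stage x) - 1)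

theorem roof_pos (x : ℤ_[2]) : 0 < roof x := by unfold roof; omega

theorem towerExp_mono : Monotone towerExp := fun i j h => by
  unfold towerExp; gcongr

/-- The increment `8 * j + 4` is the exponent of the number of columns at stage `j`. It grows, so
the three classes of columns modulo 3 become equally frequent. -/
theorem towerExp_succ (j : ℕ) : towerExp (j + 1) = towerExp j + (8 * j + 4) := by
  unfold towerExp; ring

theorem le_towerExp (j : ℕ) : j ≤ towerExp j := by
  unfold towerExp; nlinarith

theorem res_towerExp_stage (x : ℤ_[2]) : res (towerExp (stage x)) (x + 1) = 0 := by
  rcases Nat.eq_zero_or_pos (stage x) with h | h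
  · rw [h]
    -- At stage 0 the modulus is `2 ^ 0 = 1`.
    exact Subsingleton.elim (α := ZMod 1) _ _
  · have h1 : stage x - 1 ∉ {j | res (towerExp (j + 1)) (x + 1) ≠ 0} :=
      Nat.notMem_of_lt_sInf (show stage x - 1 < stage x by omega)
    have h2 : stage x - 1 + 1 = stage x := by omega
    rw [Set.mem_ofPred_eq, not_not, h2] at h1
    exact h1

theorem stage_eq {j : ℕ} {x : ℤ_[2]} (h0 : res (towerExp j) (x + 1) = 0)
    (h1 : res (towerExp (j + 1)) (x + 1) ≠ 0) : stage x = j := by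
  refine le_antisymm (Nat.sInf_le h1) (le_csInf ⟨j, h1⟩ fun i hi => ?_)
  by_contra hij
  exact hi (res_eq_zero_of_le (towerExp_mono (by omega)) h0)

theorem res_towerExp_stage_succ_ne {n : ℕ} {x : ℤ_[2]} (h : res n (x + 1) ≠ 0) :
    res (towerExp (stage x + 1)) (x + 1) ≠ 0 :=
  Nat.sInf_mem (s := {j | res (towerExp (j + 1)) (x + 1) ≠ 0})
    ⟨n, fun h0 => h (res_eq_zero_of_le ((Nat.le_succ n).trans (le_towerExp _)) h0)⟩

/-- Off the residue class of -1 the stage is below `j`, so the roof reads only the first `towerExp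
j` digits. Hence the fibres within a tower do not depend on the base point. -/
theorem roof_congr {j : ℕ} {x y : ℤ_[2]} (hxy : res (towerExp j) x = res (towerExp j) y)
    (h : res (towerExp j) (x + 1) ≠ 0) : roof x = roof y := by
  have hlt : stage x < j := by
    by_contra hle
    exact h (res_eq_zero_of_le (towerExp_mono (not_lt.1 hle)) (res_towerExp_stage x))
  have hxy1 : ∀ i ≤ j, res (towerExp i) (x + 1) = res (towerExp i) (y + 1) := fun i hi =>
    res_eq_of_le (towerExp_mono hi) (by rw [map_add, map_add, hxy])
  have hs : stage y = stage x :=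
    stage_eq ((hxy1 _ hlt.le).symm.trans (res_towerExp_stage x))
      ((hxy1 _ hlt).symm.trans_ne (res_towerExp_stage_succ_ne h))
  rw [roof, roof, hs, hxy1 _ hlt]

theorem natCast_zmod_two_pow_ne_zero {n k : ℕ} (h0 : k ≠ 0) (hk : k < 2 ^ n) :
    (k : ZMod (2 ^ n)) ≠ 0 := by
  rw [Ne, ZMod.natCast_eq_zero_iff]
  exact fun h => absurd (Nat.le_of_dvd (by omega) h) (by omega)

/-- The top of column `p` sits just before the base of column `p + 1`; the subtraction of 1 in
`roof` recovers `p`. -/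
theorem roof_of_column {j p : ℕ} (hp : p + 1 < 2 ^ (8 * j + 4)) {x : ℤ_[2]}
    (hx : res (towerExp (j + 1)) (x + 1) = ((p + 1) * 2 ^ towerExp j : ℕ)) :
    roof x = 1 + columnSpacer j p := by
  have hlt : (p + 1) * 2 ^ towerExp j < 2 ^ towerExp (j + 1) := by
    rw [towerExp_succ, pow_add, mul_comm]
    exact Nat.mul_lt_mul_of_pos_left hp (by positivity)
  have h1 : res (towerExp (j + 1)) (x + 1) ≠ 0 := by
    rw [hx]
    exact natCast_zmod_two_pow_ne_zero (by positivity) hlt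
  have h0 : res (towerExp j) (x + 1) = 0 := by
    have h2 := res_eq_of_le (towerExp_mono (Nat.le_succ j))
      (x := x + 1) (y := (((p + 1) * 2 ^ towerExp j : ℕ) : ℤ_[2])) (by rw [hx, map_natCast])
    rw [h2, map_natCast, ZMod.natCast_eq_zero_iff]
    exact dvd_mul_left _ _
  rw [roof, stage_eq h0 h1, hx, ZMod.val_natCast_of_lt hlt, Nat.mul_div_cancel _ (by positivity),
    Nat.add_sub_cancel]

theorem measurable_stage : Measurable stage := by
  refine measurable_to_countable' fun j => ?_
  have hres : ∀ n, MeasurableSet {x : ℤ_[2] | res n (x + 1) = 0} := fun n => by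
    have := (isOpen_res_fiber n 0).measurableSet
    exact (measurable_add_const (1 : ℤ_[2])) this
  -- At `x = -1` every residue of `x + 1` vanishes, and `stage` takes the default value of `sInf ∅`;
  -- this point is separated off.
  have h1 : MeasurableSet (({x : ℤ_[2] | res (towerExp j) (x + 1) = 0} \
      {x | res (towerExp (j + 1)) (x + 1) = 0}) ∪ ({-1} ∩ {_x | stage (-1) = j})) :=
    ((hres _).diff (hres _)).union ((measurableSet_singleton _).inter (.const _))
  convert h1 using 1
  ext x
  simp only [Set.mem_preimage, Set.mem_singleton_iff, Set.mem_union, Set.mem_sdiff,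
    Set.mem_ofPred_eq, Set.mem_inter_iff]
  constructor
  · rintro rfl
    by_cases hx : x = -1
    · exact .inr ⟨hx, by rw [hx]⟩
    · refine .inl ⟨res_towerExp_stage x, ?_⟩
      have : x + 1 ≠ 0 := fun h => hx (eq_neg_of_add_eq_zero_left h)
      rw [Ne, ← PadicInt.ext_of_toZModPow, not_forall] at this
      obtain ⟨n, hn⟩ := this
      rw [map_zero] at hn
      exact res_towerExp_stage_succ_ne hn
  · rintro (⟨h0, h1⟩ | ⟨h0, h1⟩)
    · exact stage_eq h0 h1
    · rw [h0, h1]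

theorem measurable_roof : Measurable roof := by
  have h : Measurable fun p : ℤ_[2] × ℕ => 1 + columnSpacer p.2
      ((res (towerExp (p.2 + 1)) (p.1 + 1)).val / 2 ^ towerExp p.2 - 1) := by
    refine measurable_from_prod_countable_left fun j => ?_
    let : MeasurableSpace (ZMod (2 ^ towerExp (j + 1))) := ⊤
    have h1 : Measurable fun x : ℤ_[2] => res (towerExp (j + 1)) (x + 1) :=
      (measurable_res _).comp (measurable_add_const (1 : ℤ_[2]))
    exact (measurable_from_top (f := fun a : ZMod (2 ^ towerExp (j + 1)) =>
      1 + columnSpacer j (a.val / 2 ^ towerExp j - 1))).comp h1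
  exact h.comp (measurable_id.prodMk measurable_stage)

/-- The roof grows at most linearly in the stage, whereas reaching stage `k` has probability `2 ^
(-4 * k ^ 2)`. The tails are thus summable and the suspension has finite measure. -/
theorem haarTwo_lt_roof_le (i : ℕ) : haarTwo {x | i < roof x} ≤ 8 * (2⁻¹ : ENNReal) ^ i := by
  set k := (i - 1) / 2
  have hsub : {x | i < roof x} ⊆ (fun x => x + 1) ⁻¹' {x | res (towerExp k) x = 0} := by
    intro x hx
    rw [Set.mem_ofPred_eq] at hx
    have h1 : spacerUnit (stage x) ≤ stage x + 1 := Nat.succ_le_succ (Nat.unpair_left_le _)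
    have h2 : roof x ≤ 1 + (stage x + 1) * 2 := by
      unfold roof columnSpacer
      exact Nat.add_le_add_left (Nat.mul_le_mul h1 (Nat.sub_le _ _)) 1
    exact res_eq_zero_of_le (towerExp_mono (by omega)) (res_towerExp_stage x)
  have hm : MeasurableSet {x : ℤ_[2] | res (towerExp k) x = 0} :=
    (isOpen_res_fiber _ 0).measurableSet
  refine (measure_mono hsub).trans ?_
  rw [measurePreserving_add_one.measure_preimage hm.nullMeasurableSet,
    ← ofReal_measureReal, haarTwo_res_fiber]
  have hexp : i ≤ towerExp k + 3 := by
    unfold towerExp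
    have : i ≤ 2 * k + 2 := by omega
    nlinarith
  have hreal : ((2 : ℝ) ^ towerExp k)⁻¹ ≤ 8 * (2⁻¹ : ℝ) ^ i := by
    have h3 : (2 : ℝ) ^ i ≤ 2 ^ towerExp k * 8 := by
      calc (2 : ℝ) ^ i ≤ 2 ^ (towerExp k + 3) := pow_le_pow_right₀ (by norm_num) hexp
        _ = _ := by rw [pow_add]; norm_num
    rw [inv_pow, ← div_eq_mul_inv, inv_le_comm₀ (by positivity) (by positivity), inv_div,
      div_le_iff₀ (by norm_num)]
    exact h3
  refine (ENNReal.ofReal_le_ofReal hreal).trans_eq ?_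
  rw [ENNReal.ofReal_mul (by norm_num), ENNReal.ofReal_pow (by norm_num),
    ENNReal.ofReal_inv_of_pos (by norm_num)]
  norm_num

theorem suspMeasure_roof_univ_ne_top : suspMeasure roof Set.univ ≠ ⊤ := by
  rw [suspMeasure_univ]
  refine ne_top_of_le_ne_top ?_ (ENNReal.tsum_le_tsum haarTwo_lt_roof_le)
  rw [ENNReal.tsum_mul_left, ENNReal.tsum_geometric]
  norm_num

theorem suspMeasure_roof_univ_ne_zero : suspMeasure roof Set.univ ≠ 0 := by
  intro h
  have h1 := measure_mono_null (Set.subset_univ (Set.univ ×ˢ {0})) h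
  rw [suspMeasure_prod_zero roof_pos .univ, measure_univ] at h1
  exact one_ne_zero h1

end Roof

/-! ### The towers of the rank-one transformation. -/

section RankOneTowers

/-- The rank-one transformation. -/
noncomputable def rankOneEquiv : ℤ_[2] × ℕ ≃ᵐ ℤ_[2] × ℕ := suspEquiv measurable_roof roof_pos

/-- Its invariant probability measure. -/
noncomputable def rankOneMeasure : Measure (ℤ_[2] × ℕ) :=
  (suspMeasure roof Set.univ)⁻¹ • suspMeasure roof

instance : IsProbabilityMeasure rankOneMeasure :=
  ⟨by rw [rankOneMeasure, Measure.smul_apply, smul_eq_mul,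
    ENNReal.inv_mul_cancel suspMeasure_roof_univ_ne_zero suspMeasure_roof_univ_ne_top]⟩

instance : NullSingletonClass rankOneMeasure :=
  ⟨fun p => by rw [rankOneMeasure, Measure.smul_apply, suspMeasure_singleton, smul_zero]⟩

theorem ergodic_rankOneEquiv : Ergodic rankOneEquiv rankOneMeasure := by
  have h := ergodic_suspFun measurable_roof roof_pos
  exact h.smul_measure _

/-- The base of the `j`-th tower. -/
def towerBase (j : ℕ) : Set (ℤ_[2] × ℕ) := {x | res (towerExp j) x = 0} ×ˢ {0}

/-- The height of the `j`-th tower. -/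
noncomputable def towerHeight (j : ℕ) : ℕ :=
  1 + ∑ k ∈ Finset.range (2 ^ towerExp j - 1), roof k

theorem zpowMap_rankOneEquiv_natCast (n : ℕ) (p : ℤ_[2] × ℕ) :
    zpowMap rankOneEquiv n p = (suspFun roof)^[n] p := by
  induction n with
  | zero => rw [Nat.cast_zero, zpowMap_zero_apply]; rfl
  | succ n ih =>
    rw [Nat.cast_succ, add_comm, zpowMap_add_apply, ih, zpowMap_one_apply,
      Function.iterate_succ_apply']
    rfl

theorem measurableSet_towerBase (j : ℕ) : MeasurableSet (towerBase j) :=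
  (isOpen_res_fiber _ 0).measurableSet.prod (measurableSet_singleton 0)

/-- The added 1 in the height is the bottom point over the last residue, which is the alternative `k
= n`. Points above it are spacers of later stages and stay outside the tower. -/
theorem exists_sum_range_add (f : ℕ → ℕ) {n l : ℕ} (hl : l < 1 + ∑ k ∈ Finset.range n, f k) :
    ∃ k i, l = ∑ k' ∈ Finset.range k, f k' + i ∧ (k < n ∧ i < f k ∨ k = n ∧ i = 0) := by
  induction n with
  | zero => exact ⟨0, 0, by simp at hl; simp [hl], .inr ⟨rfl, rfl⟩⟩
  | succ n ih =>
    by_cases h1 : l < 1 + ∑ k ∈ Finset.range n, f k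
    · obtain ⟨k, i, hki, ⟨hk, hi⟩ | ⟨rfl, rfl⟩⟩ := ih h1
      · exact ⟨k, i, hki, .inl ⟨by omega, hi⟩⟩
      · rcases Nat.eq_zero_or_pos (f k) with h0 | h0
        · exact ⟨k + 1, 0, by rw [Finset.sum_range_succ, h0]; omega, .inr ⟨rfl, rfl⟩⟩
        · exact ⟨k, 0, hki, .inl ⟨by omega, h0⟩⟩
    · rw [Finset.sum_range_succ] at hl
      by_cases h2 : l = ∑ k ∈ Finset.range (n + 1), f k
      · exact ⟨n + 1, 0, h2, .inr ⟨rfl, rfl⟩⟩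
      · rw [Finset.sum_range_succ] at h2
        exact ⟨n, l - ∑ k ∈ Finset.range n, f k, by omega, .inl ⟨by omega, by omega⟩⟩

theorem res_add_natCast {n k : ℕ} {x : ℤ_[2]} (hx : res n x = 0) : res n (x + k) = k := by
  rw [map_add, hx, zero_add, map_natCast]

theorem roof_add_natCast {j k : ℕ} {x : ℤ_[2]} (hx : res (towerExp j) x = 0)
    (hk : k < 2 ^ towerExp j - 1) : roof (x + k) = roof k := by
  refine (roof_congr (j := j) ?_ ?_).symm
  · rw [res_add_natCast hx, map_natCast]
  · have := natCast_zmod_two_pow_ne_zero (n := towerExp j) (k := k + 1) (by omega) (by omega)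
    rw [map_add, map_one, map_natCast]
    exact_mod_cast this

theorem suspFun_iterate_towerBase {j k : ℕ} {x : ℤ_[2]} (hx : res (towerExp j) x = 0)
    (hk : k ≤ 2 ^ towerExp j - 1) {i : ℕ} (hi : i < roof (x + k)) :
    (suspFun roof)^[∑ k' ∈ Finset.range k, roof k' + i] (x, 0) = (x + k, i) := by
  have h : ∑ k' ∈ Finset.range k, roof k' = ∑ k' ∈ Finset.range k, roof (x + k') :=
    Finset.sum_congr rfl fun k' hk' =>
      (roof_add_natCast hx (by have := Finset.mem_range.1 hk'; omega)).symm
  rw [h, add_comm, Function.iterate_add_apply, suspFun_iterate_sum roof_pos,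
    suspFun_iterate_of_lt hi]

/-- Position in the tower: the level `l` of the `j`-th tower sits at height `i` over the residue
class of `k`. -/
theorem exists_level_position {j l : ℕ} (hl : l < towerHeight j) :
    ∃ k i, l = ∑ k' ∈ Finset.range k, roof k' + i ∧ k < 2 ^ towerExp j ∧
      ∀ x, res (towerExp j) x = 0 → (suspFun roof)^[l] (x, 0) = (x + k, i) := by
  have hpos : 0 < 2 ^ towerExp j := by positivity
  obtain ⟨k, i, rfl, ⟨hk, hi⟩ | ⟨rfl, rfl⟩⟩ := exists_sum_range_add _ hl
  · exact ⟨k, i, rfl, by omega, fun x hx =>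
      suspFun_iterate_towerBase hx hk.le (by rwa [roof_add_natCast hx hk])⟩
  · exact ⟨_, 0, rfl, by omega, fun x hx => suspFun_iterate_towerBase hx le_rfl (roof_pos _)⟩

theorem exists_level_of_lt_roof {j i : ℕ} {x : ℤ_[2]} (hi : i < roof x)
    (hx : res (towerExp j) (x + 1) ≠ 0) :
    ∃ l < towerHeight j, ∃ x₀, res (towerExp j) x₀ = 0 ∧ (suspFun roof)^[l] (x₀, 0) = (x, i) := by
  set k := (res (towerExp j) x).val with hk
  have hkr : (k : ZMod (2 ^ towerExp j)) = res (towerExp j) x := ZMod.natCast_zmod_val _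
  have hlt : k < 2 ^ towerExp j := ZMod.val_lt _
  have hk1 : k < 2 ^ towerExp j - 1 := by
    by_contra hge
    have h1 : k + 1 = 2 ^ towerExp j := by omega
    apply hx
    rw [map_add, map_one, ← hkr, ← Nat.cast_succ, Nat.succ_eq_add_one, h1, ZMod.natCast_self]
  have hx0 : res (towerExp j) (x - k) = 0 := by rw [map_sub, map_natCast, hkr, sub_self]
  have hxk : x - k + k = x := sub_add_cancel _ _
  have hrk : roof x = roof k := by
    have := roof_add_natCast hx0 hk1
    rwa [hxk] at this
  refine ⟨∑ k' ∈ Finset.range k, roof k' + i, ?_, x - k, hx0, ?_⟩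
  · have h2 : ∑ k' ∈ Finset.range (k + 1), roof k' ≤
        ∑ k' ∈ Finset.range (2 ^ towerExp j - 1), roof k' :=
      Finset.sum_le_sum_of_subset (Finset.range_mono hk1)
    rw [Finset.sum_range_succ] at h2
    unfold towerHeight
    omega
  · have := suspFun_iterate_towerBase hx0 hk1.le (i := i) (by rwa [hxk])
    rwa [hxk] at this

theorem isTower_towerBase (j : ℕ) : IsTower rankOneEquiv (towerBase j) (towerHeight j) := by
  -- A level below the height sits at height `i` over residue `k < 2 ^ towerExp j`; it meets the
  -- base only for `k = 0` and `i = 0`.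
  have key : ∀ l, l < towerHeight j → ∀ p ∈ towerBase j, zpowMap rankOneEquiv l p ∈ towerBase j →
      l = 0 := by
    rintro l hl ⟨x, y⟩ ⟨hx, hy⟩ hmem
    obtain rfl : y = 0 := hy
    obtain ⟨k, i, rfl, hk, hpos⟩ := exists_level_position hl
    rw [zpowMap_rankOneEquiv_natCast, hpos x hx] at hmem
    obtain ⟨h1, h2⟩ := hmem
    obtain rfl : i = 0 := h2
    have h3 : res (towerExp j) (x + k) = 0 := h1
    rw [res_add_natCast hx] at h3
    obtain rfl : k = 0 := by
      by_contra h0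
      exact natCast_zmod_two_pow_ne_zero h0 hk h3
    simp
  have hlt : ∀ i k, i < k → k < towerHeight j → Disjoint
      (powImage rankOneEquiv (i : ℤ) (towerBase j)) (powImage rankOneEquiv (k : ℤ) (towerBase j)) := by
    intro i k hik hk
    rw [Set.disjoint_left]
    intro y hy hy'
    rw [mem_powImage] at hy hy'
    have h := key (k - i) (by omega) _ hy' (by
      rw [← zpowMap_add_apply]
      convert hy using 3
      omega)
    omega
  intro i hi k hk hik
  rcases lt_or_gt_of_ne hik with h | h
  · exact hlt i k h hk
  · exact (hlt k i h hi).symm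

end RankOneTowers

/-! ### The towers fill the space and generate. -/

section Generation

/-- The points outside the `j`-th tower are contained in the set of points above the roof or over
the residue class of `-1`. -/
def towerDefect (j : ℕ) : Set (ℤ_[2] × ℕ) :=
  {p | roof p.1 ≤ p.2} ∪ {p | res (towerExp j) (p.1 + 1) = 0}

theorem exists_level_of_notMem_towerDefect {j : ℕ} {p : ℤ_[2] × ℕ} (hp : p ∉ towerDefect j) :
    ∃ l < towerHeight j, ∃ q ∈ towerBase j, zpowMap rankOneEquiv l q = p := by
  obtain ⟨x, i⟩ := p
  simp only [towerDefect, Set.mem_union, Set.mem_ofPred_eq, not_or, not_le] at hp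
  obtain ⟨l, hl, x₀, hx₀, h⟩ := exists_level_of_lt_roof hp.1 hp.2
  exact ⟨l, hl, (x₀, 0), ⟨hx₀, rfl⟩, by rw [zpowMap_rankOneEquiv_natCast, h]⟩

theorem tendsto_measure_towerDefect :
    Tendsto (fun j => rankOneMeasure (towerDefect j)) atTop (𝓝 0) := by
  have h0 : rankOneMeasure {p | roof p.1 ≤ p.2} = 0 := by
    rw [rankOneMeasure, Measure.smul_apply, suspMeasure_setOf_le measurable_roof, smul_zero]
  have hm : ∀ j, MeasurableSet {p : ℤ_[2] × ℕ | res (towerExp j) (p.1 + 1) = 0} := fun j =>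
    (measurable_fst.add_const 1) (isOpen_res_fiber _ 0).measurableSet
  have hanti : Antitone fun j => {p : ℤ_[2] × ℕ | res (towerExp j) (p.1 + 1) = 0} :=
    fun i j hij p hp => res_eq_zero_of_le (towerExp_mono hij) hp
  -- Only the fibre over the point -1 remains in all the defects, and it is countable.
  have hInter : rankOneMeasure (⋂ j, {p : ℤ_[2] × ℕ | res (towerExp j) (p.1 + 1) = 0}) = 0 := by
    refine measure_mono_null (t := ⋃ i : ℕ, {((-1 : ℤ_[2]), i)}) ?_
      (measure_iUnion_null fun i => measure_singleton _)
    rintro ⟨x, i⟩ hp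
    rw [Set.mem_iInter] at hp
    have hx : x + 1 = 0 := PadicInt.ext_of_toZModPow.1 fun n => by
      rw [map_zero]
      exact res_eq_zero_of_le (le_towerExp n) (hp n)
    rw [eq_neg_of_add_eq_zero_left hx]
    exact Set.mem_iUnion.2 ⟨i, rfl⟩
  have hlim := tendsto_measure_iInter_atTop (μ := rankOneMeasure)
    (fun j => (hm j).nullMeasurableSet) hanti ⟨0, measure_ne_top _ _⟩
  rw [hInter] at hlim
  refine tendsto_of_tendsto_of_tendsto_of_le_of_le tendsto_const_nhds hlim (fun _ => zero_le)
    fun j => ?_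
  exact (measure_union_le _ _).trans (by rw [h0, zero_add]; rfl)

theorem tendsto_measure_compl_levelUnion :
    Tendsto (fun j => rankOneMeasure
      (levelUnion rankOneEquiv (towerBase j) (Set.Iio (towerHeight j)))ᶜ) atTop (𝓝 0) := by
  refine tendsto_of_tendsto_of_tendsto_of_le_of_le tendsto_const_nhds tendsto_measure_towerDefect
    (fun _ => zero_le) fun j => measure_mono fun p hp => ?_
  by_contra hd
  obtain ⟨l, hl, q, hq, rfl⟩ := exists_level_of_notMem_towerDefect hd
  exact hp (((isTower_towerBase j).mem_levelUnion_iff (fun i hi => hi) hl hq).2 hl)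

/-- Each level consists of points at one height over one residue class. Such a set therefore
contains a level or misses it, and only the defect is lost. -/
theorem isTowerApproximable_of_res {A : Set (ℤ_[2] × ℕ)} {j₀ : ℕ}
    (hA : ∀ j ≥ j₀, ∀ x y i, res (towerExp j) x = res (towerExp j) y →
      ((x, i) ∈ A ↔ (y, i) ∈ A)) :
    IsTowerApproximable rankOneEquiv rankOneMeasure towerBase towerHeight A := by
  intro ε hε
  filter_upwards [ENNReal.tendsto_nhds_zero.1 tendsto_measure_towerDefect ε hε,
    eventually_ge_atTop j₀] with j hj hj₀
  refine ⟨{l | l < towerHeight j ∧ zpowMap rankOneEquiv l (0, 0) ∈ A}, fun l hl => hl.1, ?_⟩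
  refine (measure_mono fun p hp => ?_).trans hj
  by_contra hd
  obtain ⟨l, hl, ⟨x, y⟩, hq, rfl⟩ := exists_level_of_notMem_towerDefect hd
  have hx : res (towerExp j) x = 0 := hq.1
  obtain rfl : y = 0 := hq.2
  obtain ⟨k, i, -, -, hpos⟩ := exists_level_position hl
  have hmem : zpowMap rankOneEquiv l (x, 0) ∈ A ↔ zpowMap rankOneEquiv l (0, 0) ∈ A := by
    rw [zpowMap_rankOneEquiv_natCast, zpowMap_rankOneEquiv_natCast, hpos x hx,
      hpos 0 (map_zero _)]
    exact hA j hj₀ _ _ i (by rw [res_add_natCast hx, res_add_natCast (map_zero _)])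
  rw [Set.mem_symmDiff, (isTower_towerBase j).mem_levelUnion_iff (fun l hl => hl.1) hl hq, hmem]
    at hp
  simp only [Set.mem_ofPred_eq, hl, true_and] at hp
  tauto

theorem isGeneratingTowers_towerBase :
    IsGeneratingTowers rankOneEquiv rankOneMeasure towerBase towerHeight where
  measurableSet := measurableSet_towerBase
  isTower := isTower_towerBase
  exists_approx A hA := by
    suffices h : (Prod.instMeasurableSpace : MeasurableSpace (ℤ_[2] × ℕ)) ≤
        towerApproximableSpace isTower_towerBase tendsto_measure_compl_levelUnion from
      (h A hA).2.exists_tendsto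
    refine sup_le (MeasurableSpace.comap_le_iff_le_map.2 (borel_le_of_res_fiber _ fun n a => ?_))
      (MeasurableSpace.comap_le_iff_le_map.2 fun s _ => ?_)
    · refine ⟨measurable_fst (isOpen_res_fiber n a).measurableSet,
        isTowerApproximable_of_res (j₀ := n) fun j hj x y i hxy => ?_⟩
      simp only [Set.mem_preimage, Set.mem_ofPred_eq]
      rw [res_eq_of_le (hj.trans (le_towerExp j)) hxy]
    · exact ⟨measurable_snd (MeasurableSet.of_discrete),
        isTowerApproximable_of_res (j₀ := 0) fun j hj x y i hxy => Iff.rfl⟩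

theorem tendsto_towerHeight : Tendsto towerHeight atTop atTop := by
  refine tendsto_atTop_mono (fun j => ?_) tendsto_id
  have h1 : ∑ _k ∈ Finset.range (2 ^ towerExp j - 1), 1 ≤
      ∑ k ∈ Finset.range (2 ^ towerExp j - 1), roof k :=
    Finset.sum_le_sum fun k _ => roof_pos _
  rw [Finset.sum_const, Finset.card_range, smul_eq_mul, mul_one] at h1
  have h2 : towerExp j < 2 ^ towerExp j := Nat.lt_two_pow_self
  have h3 := le_towerExp j
  unfold towerHeight
  simp only [id]
  omega

theorem isRankOne_rankOneEquiv : IsRankOne rankOneEquiv rankOneMeasure :=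
  ⟨ergodic_rankOneEquiv.toMeasurePreserving, towerHeight, towerBase, measurableSet_towerBase,
    isTower_towerBase, isGeneratingTowers_towerBase.exists_approx⟩

end Generation

/-! ### Column classes, their frequencies and return times. -/

section Columns

/-- The columns of the `j`-th tower of index congruent to `c` modulo `3`, the first two columns
being omitted. -/
def columnClass (j c : ℕ) : Set (ℤ_[2] × ℕ) :=
  {x | ∃ q < 2 ^ (8 * j + 4) - 2, (q + 2) % 3 = c ∧
    res (towerExp (j + 1)) x = ((q + 2) * 2 ^ towerExp j : ℕ)} ×ˢ {0}

theorem res_towerExp_eq_zero_of_column {j p : ℕ} {x : ℤ_[2]}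
    (hx : res (towerExp (j + 1)) x = (p * 2 ^ towerExp j : ℕ)) : res (towerExp j) x = 0 := by
  have h := res_eq_of_le (towerExp_mono (Nat.le_succ j)) (x := x)
    (y := ((p * 2 ^ towerExp j : ℕ) : ℤ_[2])) (by rw [hx, map_natCast])
  rw [h, map_natCast, ZMod.natCast_eq_zero_iff]
  exact dvd_mul_left _ _

theorem columnClass_subset (j c : ℕ) : columnClass j c ⊆ towerBase j := by
  rintro ⟨x, y⟩ ⟨⟨q, -, -, hx⟩, hy⟩
  exact ⟨res_towerExp_eq_zero_of_column hx, hy⟩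

theorem column_lt {j q : ℕ} (hq : q < 2 ^ (8 * j + 4)) :
    q * 2 ^ towerExp j < 2 ^ towerExp (j + 1) := by
  rw [towerExp_succ, pow_add, mul_comm]
  exact Nat.mul_lt_mul_of_pos_left hq (by positivity)

theorem column_inj {j q q' : ℕ} (hq : q < 2 ^ (8 * j + 4)) (hq' : q' < 2 ^ (8 * j + 4))
    (h : ((q * 2 ^ towerExp j : ℕ) : ZMod (2 ^ towerExp (j + 1))) =
      (q' * 2 ^ towerExp j : ℕ)) : q = q' := by
  have := congrArg ZMod.val h
  rw [ZMod.val_natCast_of_lt (column_lt hq), ZMod.val_natCast_of_lt (column_lt hq')] at this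
  exact Nat.eq_of_mul_eq_mul_right (by positivity) this

theorem disjoint_columnClass (j : ℕ) {c d : ℕ} (hcd : c ≠ d) :
    Disjoint (columnClass j c) (columnClass j d) := by
  rw [Set.disjoint_left]
  rintro ⟨x, y⟩ ⟨⟨q, hq, rfl, hx⟩, -⟩ ⟨⟨q', hq', rfl, hx'⟩, -⟩
  have := column_inj (by omega) (by omega) (hx.symm.trans hx')
  exact hcd (by rw [this])

/-- The residues of the columns of `columnClass j c`. -/
def columnIndices (j c : ℕ) : Finset ℕ :=
  (Finset.range (2 ^ (8 * j + 4) - 2)).filter fun q => (q + 2) % 3 = c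

theorem columnClass_eq (j c : ℕ) : columnClass j c = (⋃ q ∈ columnIndices j c,
    {x | res (towerExp (j + 1)) x = ((q + 2) * 2 ^ towerExp j : ℕ)}) ×ˢ {0} := by
  unfold columnClass
  congr 1
  ext x
  simp [columnIndices, and_assoc]

theorem measurableSet_columnClass (j c : ℕ) : MeasurableSet (columnClass j c) := by
  rw [columnClass_eq]
  exact (Finset.measurableSet_biUnion _ fun q _ =>
    (isOpen_res_fiber _ _).measurableSet).prod (measurableSet_singleton 0)

theorem rankOneMeasure_real_prod_zero {V : Set ℤ_[2]} (hV : MeasurableSet V) :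
    rankOneMeasure.real (V ×ˢ {0}) = (suspMeasure roof Set.univ)⁻¹.toReal * haarTwo.real V := by
  rw [measureReal_def, rankOneMeasure, Measure.smul_apply, smul_eq_mul, ENNReal.toReal_mul,
    suspMeasure_prod_zero roof_pos hV, measureReal_def]

theorem haarTwo_real_columns (j c : ℕ) :
    haarTwo.real (⋃ q ∈ columnIndices j c,
      {x | res (towerExp (j + 1)) x = ((q + 2) * 2 ^ towerExp j : ℕ)}) =
      (columnIndices j c).card * (2 ^ towerExp (j + 1) : ℝ)⁻¹ := by
  rw [measureReal_biUnion_finset]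
  · simp only [haarTwo_res_fiber, Finset.sum_const, nsmul_eq_mul]
  · intro q hq q' hq' hne
    rw [Function.onFun, Set.disjoint_left]
    intro x hx hx'
    have h1 := Finset.mem_range.1 (Finset.mem_filter.1 hq).1
    have h2 := Finset.mem_range.1 (Finset.mem_filter.1 hq').1
    have := column_inj (by omega) (by omega) (hx.symm.trans hx')
    omega
  · exact fun q _ => (isOpen_res_fiber _ _).measurableSet

theorem columnClass_ratio (j c : ℕ) :
    rankOneMeasure.real (columnClass j c) / rankOneMeasure.real (towerBase j) =
      (columnIndices j c).card / 2 ^ (8 * j + 4) := by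
  have hc : (suspMeasure roof Set.univ)⁻¹.toReal ≠ 0 :=
    ENNReal.toReal_ne_zero.2 ⟨ENNReal.inv_ne_zero.2 suspMeasure_roof_univ_ne_top,
      ENNReal.inv_ne_top.2 suspMeasure_roof_univ_ne_zero⟩
  rw [columnClass_eq, towerBase, rankOneMeasure_real_prod_zero (Finset.measurableSet_biUnion _
    fun q _ => (isOpen_res_fiber _ _).measurableSet), rankOneMeasure_real_prod_zero
    (isOpen_res_fiber _ _).measurableSet, mul_div_mul_left _ _ hc, haarTwo_real_columns,
    haarTwo_res_fiber, towerExp_succ, pow_add]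
  field_simp

theorem card_filter_add_two_mod_three (n : ℕ) {c : ℕ} (hc : c < 3) :
    ((Finset.range n).filter fun q => (q + 2) % 3 = c).card = (n + 2 - (c + 1) % 3) / 3 := by
  induction n with
  | zero => simp; omega
  | succ n ih =>
    rw [Finset.range_add_one, Finset.filter_insert]
    split_ifs with h
    · rw [Finset.card_insert_of_notMem (by simp), ih]; omega
    · rw [ih]; omega

theorem tendsto_columnClass_ratio {c : ℕ} (hc : c < 3) :
    Tendsto (fun j => rankOneMeasure.real (columnClass j c) / rankOneMeasure.real (towerBase j))
      atTop (𝓝 (1 / 3)) := by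
  simp only [columnClass_ratio]
  rw [tendsto_iff_dist_tendsto_zero]
  have hinv : Tendsto (fun j : ℕ => 2 * ((2 : ℝ)⁻¹) ^ j) atTop (𝓝 0) := by
    simpa using (tendsto_pow_atTop_nhds_zero_of_lt_one (r := (2 : ℝ)⁻¹) (by norm_num)
      (by norm_num)).const_mul 2
  refine squeeze_zero (fun _ => dist_nonneg) (fun j => ?_) hinv
  set r := 2 ^ (8 * j + 4) with hr
  have hr2 : 2 ≤ r := by
    calc 2 = 2 ^ 1 := rfl
      _ ≤ r := Nat.pow_le_pow_right (by norm_num) (by omega)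
  have hcard := card_filter_add_two_mod_three (r - 2) hc
  have hci : (columnIndices j c).card = (r - 2 + 2 - (c + 1) % 3) / 3 := hcard
  have h1 : 3 * (columnIndices j c).card ≤ r := by omega
  have h2 : r ≤ 3 * (columnIndices j c).card + 4 := by omega
  have h1' : (3 : ℝ) * (columnIndices j c).card ≤ r := by exact_mod_cast h1
  have h2' : (r : ℝ) ≤ 3 * (columnIndices j c).card + 4 := by exact_mod_cast h2
  have hrr : (2 : ℝ) ^ (8 * j + 4) = r := by rw [hr]; push_cast; rfl
  have hrpos : (0 : ℝ) < r := by rw [← hrr]; positivity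
  have hle : (r : ℝ)⁻¹ ≤ (2 : ℝ)⁻¹ ^ j := by
    rw [inv_pow, ← hrr]
    exact inv_anti₀ (by positivity) (pow_le_pow_right₀ (by norm_num) (by omega))
  rw [hrr, Real.dist_eq]
  -- Omitting two columns and rounding change three times the count by at most 4, and `4 / 3 ≤ 2`.
  have e : ((columnIndices j c).card : ℝ) / r - 1 / 3 =
      ((3 * (columnIndices j c).card - r) / 3) * (r : ℝ)⁻¹ := by
    field_simp
  rw [e, abs_mul, abs_of_pos (inv_pos.2 hrpos)]
  refine mul_le_mul ?_ hle (inv_pos.2 hrpos).le (by norm_num)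
  rw [abs_le]
  constructor <;> linarith

/-- The return map to the base of the `j`-th tower on its `p`-th column. -/
theorem zpowMap_column {j p : ℕ} (hp : p + 1 < 2 ^ (8 * j + 4)) {x : ℤ_[2]}
    (hx : res (towerExp (j + 1)) x = (p * 2 ^ towerExp j : ℕ)) :
    zpowMap rankOneEquiv ((towerHeight j + columnSpacer j p : ℕ) : ℤ) (x, 0) =
      (x + (2 ^ towerExp j : ℕ), 0) := by
  have hx0 := res_towerExp_eq_zero_of_column hx
  have hpos : 0 < 2 ^ towerExp j := by positivity
  set M := 2 ^ towerExp j with hM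
  have hM1 : M - 1 + 1 = M := by omega
  have hcast : x + ((M - 1 : ℕ) : ℤ_[2]) + 1 = x + (M : ℕ) := by
    rw [add_assoc, ← Nat.cast_succ, Nat.succ_eq_add_one, hM1]
  have hroof : roof (x + ((M - 1 : ℕ) : ℤ_[2])) = 1 + columnSpacer j p := by
    refine roof_of_column hp ?_
    rw [hcast, map_add, hx, map_natCast, ← hM, add_mul, one_mul, Nat.cast_add]
  -- The return time is the sum of the roofs over the whole column: the height accounts for all but
  -- the spacers above the last fibre.
  have hsum : ∑ k ∈ Finset.range M, roof (x + k) = towerHeight j + columnSpacer j p := by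
    have e : ∑ k ∈ Finset.range (M - 1), roof (x + k) = ∑ k ∈ Finset.range (M - 1), roof k :=
      Finset.sum_congr rfl fun k hk => roof_add_natCast hx0 (Finset.mem_range.1 hk)
    conv_lhs => rw [← hM1]
    rw [Finset.sum_range_succ, hroof, towerHeight, e]
    ring
  rw [zpowMap_rankOneEquiv_natCast, ← hsum, suspFun_iterate_sum roof_pos]

theorem zpowMap_neg_column {j p : ℕ} (hp : p + 1 < 2 ^ (8 * j + 4)) {x : ℤ_[2]}
    (hx : res (towerExp (j + 1)) x = ((p + 1) * 2 ^ towerExp j : ℕ)) :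
    zpowMap rankOneEquiv (-((towerHeight j + columnSpacer j p : ℕ) : ℤ)) (x, 0) =
      (x - (2 ^ towerExp j : ℕ), 0) := by
  have h := zpowMap_column hp (x := x - (2 ^ towerExp j : ℕ)) (by
    rw [map_sub, hx, map_natCast, add_mul, one_mul, Nat.cast_add, add_sub_cancel_right])
  rw [sub_add_cancel] at h
  rw [← h, zpowMap_neg_apply_self]

end Columns

/-! ### Property (P) for the rank-one transformation. -/

section TripleLimits

/-- Columns `p - 1` and `p - 2` have index `c + 2` and `c + 1` modulo 3, which determines the
spacers crossed when going back. Two steps back explain the omission of the first two columns. -/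
theorem zpowMap_neg_columnClass {j c : ℕ} {z : ℤ_[2] × ℕ} (hz : z ∈ columnClass j c) :
    zpowMap rankOneEquiv (-((towerHeight j + spacerUnit j * (2 - (c + 2) % 3) : ℕ) : ℤ)) z ∈
        towerBase j ∧
      zpowMap rankOneEquiv (-((2 * towerHeight j + spacerUnit j * (2 - (c + 2) % 3) +
        spacerUnit j * (2 - (c + 1) % 3) : ℕ) : ℤ)) z ∈ towerBase j := by
  obtain ⟨x, y⟩ := z
  obtain ⟨⟨q, hq, hqc, hx⟩, hy⟩ := hz
  obtain rfl : y = 0 := hy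
  have h1 := zpowMap_neg_column (j := j) (p := q + 1) (by omega) hx
  have hx' : res (towerExp (j + 1)) (x - (2 ^ towerExp j : ℕ)) =
      ((q + 1) * 2 ^ towerExp j : ℕ) := by
    rw [map_sub, hx, map_natCast, show q + 2 = q + 1 + 1 from rfl, add_mul (q + 1), one_mul,
      Nat.cast_add, add_sub_cancel_right]
  have h2 := zpowMap_neg_column (j := j) (p := q) (by omega) hx'
  have hx'' : res (towerExp (j + 1)) (x - (2 ^ towerExp j : ℕ) - (2 ^ towerExp j : ℕ)) =
      (q * 2 ^ towerExp j : ℕ) := by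
    rw [map_sub, hx', map_natCast, add_mul, one_mul, Nat.cast_add, add_sub_cancel_right]
  have e1 : columnSpacer j (q + 1) = spacerUnit j * (2 - (c + 2) % 3) := by
    unfold columnSpacer; congr 2; omega
  have e2 : columnSpacer j q = spacerUnit j * (2 - (c + 1) % 3) := by
    unfold columnSpacer; congr 2; omega
  rw [e1] at h1
  rw [e2] at h2
  refine ⟨?_, ?_⟩
  · rw [h1]
    exact ⟨res_towerExp_eq_zero_of_column hx', rfl⟩
  · have hsplit : -((2 * towerHeight j + spacerUnit j * (2 - (c + 2) % 3) +
        spacerUnit j * (2 - (c + 1) % 3) : ℕ) : ℤ) =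
        -((towerHeight j + spacerUnit j * (2 - (c + 1) % 3) : ℕ) : ℤ) +
        -((towerHeight j + spacerUnit j * (2 - (c + 2) % 3) : ℕ) : ℤ) := by
      push_cast; ring
    rw [hsplit, zpowMap_add_apply, h1, h2]
    exact ⟨res_towerExp_eq_zero_of_column hx'', rfl⟩

theorem hasTripleLimits_rankOneEquiv : HasTripleLimits rankOneEquiv rankOneMeasure := by
  intro N hN
  -- Along these stages the spacer unit is constantly `N`.
  set s : ℕ → ℕ := fun k => Nat.pair (N - 1) k with hs
  have hst : Tendsto s atTop atTop :=
    tendsto_atTop_mono (fun k => Nat.right_le_pair (N - 1) k) tendsto_id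
  have hunit : ∀ k, spacerUnit (s k) = N := fun k => by
    simp only [hs, spacerUnit, Nat.unpair_pair]; omega
  refine ⟨fun k => towerHeight (s k) + N,
    tendsto_atTop_mono (fun k => Nat.le_add_right _ _) (tendsto_towerHeight.comp hst),
    fun A₁ A₂ A₃ h₁ h₂ h₃ => ?_⟩
  have key := (isGeneratingTowers_towerBase.comp hst).tendsto_triple
    ergodic_rankOneEquiv.toMeasurePreserving (tendsto_towerHeight.comp hst) (ι := Fin 3)
    (W := fun k c => columnClass (s k) c) (fun k c => measurableSet_columnClass _ _)
    (fun k c => columnClass_subset _ _)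
    (fun k c d hcd => disjoint_columnClass _ fun h => hcd (Fin.ext h)) (w := fun _ => 1 / 3)
    (fun c => (tendsto_columnClass_ratio c.2).comp hst) (by simp)
    (u := fun k => ((towerHeight (s k) + N : ℕ) : ℤ) + N)
    (v := fun k => 2 * ((towerHeight (s k) + N : ℕ) : ℤ))
    -- Going back one column crosses `0`, `2N`, `N` spacers for `c = 0, 1, 2`, and going back two
    -- crosses `N`, `2N`, `3N`. Subtracting these from the `2N` in both `u` and `v` gives `α` and
    -- `β`.
    (α := ![2 * (N : ℤ), 0, N]) (β := ![(N : ℤ), 0, -N]) (L := 2 * N)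
    (by
      intro c
      fin_cases c <;> (simp; try omega))
    (by
      intro c
      fin_cases c <;> (simp; try omega))
    (by
      intro k c z hz
      have h := (zpowMap_neg_columnClass hz).1
      rw [hunit] at h
      convert h using 3
      fin_cases c <;> simp <;> ring)
    (by
      intro k c z hz
      have h := (zpowMap_neg_columnClass hz).2
      rw [hunit] at h
      convert h using 3
      fin_cases c <;> simp <;> ring)
    h₁ h₂ h₃
  convert key using 2
  have h0 : ∀ A : Set (ℤ_[2] × ℕ), powImage rankOneEquiv 0 A = A := fun A => by
    ext x; rw [mem_powImage, neg_zero, zpowMap_zero_apply]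
  simp only [Fin.sum_univ_three, Matrix.cons_val_zero, Matrix.cons_val_one, Matrix.cons_val, h0]
  ring

end TripleLimits

theorem mainTheorem2 :
    (∃ (X : Type) (_ : MeasurableSpace X) (_ : StandardBorelSpace X) (μ : Measure X)
        (_ : IsProbabilityMeasure μ) (_ : NullSingletonClass μ) (T : X ≃ᵐ X),
      Ergodic T μ ∧ IsRankOne T μ ∧ HasTripleLimits T μ ∧ IsWeaklyMixing T μ) ∧
    (∀ (X : Type*) (_ : MeasurableSpace X) (μ : Measure X) (_ : IsProbabilityMeasure μ)
        (T : X ≃ᵐ X),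
      Ergodic T μ → HasTripleLimits T μ → IsWeaklyMixing T μ) := by
  refine ⟨⟨ℤ_[2] × ℕ, inferInstance, inferInstance, rankOneMeasure, inferInstance, inferInstance,
    rankOneEquiv, ergodic_rankOneEquiv, isRankOne_rankOneEquiv, hasTripleLimits_rankOneEquiv,
    isWeaklyMixing_of_hasTripleLimits ergodic_rankOneEquiv hasTripleLimits_rankOneEquiv⟩, ?_⟩
  intro X _ μ _ T hT h
  exact isWeaklyMixing_of_hasTripleLimits hT h
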